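/- **Theorem 2.3 (Whittaker transform).** For $a\in\mathbb N=\{1,2,\dots\}$, $p,b,c,\mu\in\mathbb C$, $\lambda,\xi>0$ let $${}_aW^{\lambda,\mu}_{p,b,c,\xi}(z)=\sum_{k=0}^\infty\frac{(-c)^k}{\Gamma(\lambda k+\mu)\,\Gamma\!\left(ak+\frac p\xi+\frac{b+2}2\right)}\left(\frac z2\right)^{2k+p+1}$$ be the generalized Galué type Struve function (principal powers, $1/\Gamma=0$ at the poles of $\Gamma$), let $${}_m\Psi_n\!\left[{(a_i,\alpha_i)_{i\le m}\atop(b_j,\beta_j)_{j\le n}}\middle|z\right]=\sum_{k=0}^\infty\frac{\prod_{i=1}^m\Gamma(a_i+\alpha_ik)}{\prod_{j=1}^n\Gamma(b_j+\beta_jk)}\frac{z^k}{k!}$$ be the generalized Wright function, and let $W_{\tau,\omega}$ be the Whittaker function, that is $$W_{\tau,\omega}(z)=\frac{\Gamma(-2\omega)}{\Gamma(\frac12-\tau-\omega)}M_{\tau,\omega}(z)+\frac{\Gamma(2\omega)}{\Gamma(\frac12-\tau+\omega)}M_{\tau,-\omega}(z),\qquad M_{\tau,\omega}(z)=z^{1/2+\omega}e^{-z/2}{}_1F_1\!\left(\tfrac12+\omega-\tau;2\omega+1;z\right),$$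 extended by its limit in $\omega$ to the values with $2\omega\in\mathbb Z$. Let $\tau,\omega,\zeta,x\in\mathbb C$ with $\Re(\zeta)>0$, $\Re(p)>0$ and $\Re(\zeta\pm\omega)>-\frac12$, and suppose that $\lambda+a>2$, or that $\lambda+a=2$ and $|cx|<1$, or that $c=0$. Then, with the principal square root of $x$, the integral and the series below converge absolutely and $$\int_0^\infty t^{\zeta-1}e^{-t/2}\,W_{\tau,\omega}(t)\;{}_aW^{\lambda,\mu}_{p,b,c,\xi}(x^{1/2}t)\,dt=\left(\frac{\sqrt x}2\right)^{p+1}{}_3\Psi_3\!\left[{(\omega+\zeta+p+\frac32,2),\;(-\omega+\zeta+p+\frac32,2),\;(1,1)\atop(\mu,\lambda),\;(\frac p\xi+\frac b2+1,a),\;(-\tau+\zeta+p+2,2)}\middle|-\frac{cx}4\right].$$ -/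

import Mathlib

open MeasureTheory Filter Topology

noncomputable section

/-- The generalized Galué type Struve function
`∑ₖ (-c)ᵏ / (Γ(λk + μ) Γ(ak + p/ξ + (b+2)/2)) (z/2)^(2k+p+1)` (principal power).
At the poles of `Γ` Mathlib has `Γ = 0`, so that division by it gives the usual value
`1/Γ = 0`. -/
def galueStruve (a : ℕ) (p b c : ℂ) (ξ l : ℝ) (μ : ℂ) (z : ℂ) : ℂ :=
  ∑' k : ℕ, (-c) ^ k /
      (Complex.Gamma (l * k + μ) * Complex.Gamma (a * k + p / ξ + (b + 2) / 2)) *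
    (z / 2) ^ (2 * k + p + 1 : ℂ)

/-- The `k`-th term of the generalized Wright function; the upper parameters are the pairs
`(A i).1 = aᵢ`, `(A i).2 = αᵢ`, the lower ones `(B j).1 = bⱼ`, `(B j).2 = βⱼ`. -/
def wrightTerm {m n : ℕ} (A : Fin m → ℂ × ℝ) (B : Fin n → ℂ × ℝ) (z : ℂ) (k : ℕ) : ℂ :=
  (∏ i, Complex.Gamma ((A i).1 + (A i).2 * k)) * z ^ k /
    ((∏ j, Complex.Gamma ((B j).1 + (B j).2 * k)) * (Nat.factorial k : ℂ))

/-- The generalized Wright hypergeometric function `ₘΨₙ`. -/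
def wrightPsi {m n : ℕ} (A : Fin m → ℂ × ℝ) (B : Fin n → ℂ × ℝ) (z : ℂ) : ℂ :=
  ∑' k : ℕ, wrightTerm A B z k

/-- Kummer's confluent hypergeometric function `₁F₁(α; β; z)`. -/
def kummerF (α β z : ℂ) : ℂ :=
  ∑' k : ℕ, (ascPochhammer ℂ k).eval α / (ascPochhammer ℂ k).eval β *
    (z ^ k / (Nat.factorial k : ℂ))

/-- The Whittaker function `M_{τ,ω}`. -/
def whittakerM (τ ω z : ℂ) : ℂ :=
  z ^ (1 / 2 + ω) * Complex.exp (-z / 2) * kummerF (1 / 2 + ω - τ) (2 * ω + 1) z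

/-- The expression of `W_{τ,ω}` through `M_{τ,ω}` and `M_{τ,-ω}`, meaningful for `2ω ∉ ℤ`. -/
def whittakerConnection (τ ω z : ℂ) : ℂ :=
  Complex.Gamma (-2 * ω) / Complex.Gamma (1 / 2 - τ - ω) * whittakerM τ ω z +
    Complex.Gamma (2 * ω) / Complex.Gamma (1 / 2 - τ + ω) * whittakerM τ (-ω) z

open Classical in
/-- The Whittaker function `W_{τ,ω}`: the combination of `M_{τ,ω}` and `M_{τ,-ω}` if `2ω` is
not an integer, and, as usual, its limit in the second index if `2ω` is an integer. -/
def whittakerW (τ ω z : ℂ) : ℂ :=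
  if ∃ n : ℤ, 2 * ω = n then
    limUnder (𝓝[≠] ω) (fun s : ℂ => whittakerConnection τ s z)
  else whittakerConnection τ ω z

end

/-! Expand the Struve function in its power series. Since `t` is a positive real, `t^(2k+p+1)`
splits off from the principal power, and the `k`-th term becomes a constant times the Mellin
transform of `e^(-t/2) W_{τ,ω}(t)` at `s = ζ + p + 1 + 2k`. That transform is `Γ(1/2+ω+s) Γ(1/2-ω+s)
/ Γ(1-τ+s)`, which produces exactly the Wright terms; the parameter pair `(1,1)` cancels `k!`.

The substance is the Mellin transform, because `W` is defined through `M_{τ,±ω}`, from which its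
decay cannot be read off. If `Re(1/2+ω-τ) > 0`, then `W` is `e^(-t/2) t^(1/2+ω)` times Tricomi's
integral divided by its Gamma factor (`whittakerConnection_eq_tricomiIntegral`), and Fubini reduces
the transform to a Gamma and a beta integral (`mellin_tricomiIntegral`). The representation itself
is the connection formula `tricomiIntegral_connection`: Tricomi's integral and two Frobenius series
solve Kummer's equation, their weighted Wronskians are constant by Abel's identity and are computed
at the origin for `0 < Re β < 1`; the identity theorem in `β` does the rest. Working with
`₁F₁/Γ(c)`, entire in every argument, removes exceptional parameters. Integer `2ω` is reached
because Tricomi's representation is continuous in `ω`.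

The restriction on `τ` is lifted by the three-term recurrence expressing `W_{τ+1}` through `W_τ` and
`W_{τ-1}`. Limit, Mellin transform and moment bounds all pass through it, so they are bundled in
`IsWhittakerOnHalfLine` and proved together by induction.

Sum and integral may be exchanged because the absolute moments are at most `C Γ(Re s + N)` for large
`Re s`. The resulting series of Gamma quotients passes the ratio test exactly because of the
hypothesis on `λ + a` (`summable_gammaQuotient`). -/

/-! ### The regularized Kummer function -/

/-- The `n`-th term of the regularized Kummer series. -/
noncomputable def kummerRegTerm (a c z : ℂ) (n : ℕ) : ℂ :=
  (ascPochhammer ℂ n).eval a * (Complex.Gamma (c + n))⁻¹ * (z ^ n / (Nat.factorial n : ℂ))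

/-- The regularized Kummer function `₁F₁(a; c; z) / Γ(c)`, entire in all its arguments. -/
noncomputable def kummerReg (a c z : ℂ) : ℂ :=
  ∑' n : ℕ, kummerRegTerm a c z n

theorem norm_ascPochhammer_eval_le {N : ℕ} (hN : 1 ≤ N) {a : ℂ} (ha : ‖a‖ ≤ N) (n : ℕ) :
    ‖(ascPochhammer ℂ n).eval a‖ ≤ (N : ℝ) ^ n * (n.factorial : ℝ) := by
  induction n with
  | zero => simp
  | succ n ih =>
    rw [ascPochhammer_succ_eval, norm_mul]
    have h1 : ‖a + n‖ ≤ N * (n + 1) := by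
      calc ‖a + n‖ ≤ ‖a‖ + ‖(n : ℂ)‖ := norm_add_le _ _
        _ ≤ N + n := by rw [Complex.norm_natCast]; linarith
        _ ≤ N * (n + 1) := by
          have : (1 : ℝ) ≤ N := by exact_mod_cast hN
          nlinarith [(Nat.cast_nonneg n : (0 : ℝ) ≤ n)]
    calc _ ≤ ((N : ℝ) ^ n * (n.factorial : ℝ)) * (N * (n + 1)) := by gcongr
      _ = _ := by rw [Nat.factorial_succ]; push_cast; ring

/-- From `n = N` on, each use of `Γ(w+1) = w Γ(w)` divides by `|c+n| ≥ n-N+1`; the earlier `n` are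
covered by compactness, as `1/Γ` is entire. The truncated `n - N` makes the factorial `1` there. -/
theorem exists_norm_inv_Gamma_add_nat_le (N : ℕ) :
    ∃ K : ℝ, 0 ≤ K ∧ ∀ (c : ℂ) (n : ℕ), ‖c‖ + 1 ≤ N →
      ‖(Complex.Gamma (c + n))⁻¹‖ ≤ K / ((n - N).factorial : ℝ) := by
  obtain ⟨K, hK⟩ := (isCompact_closedBall (0 : ℂ) (2 * N)).exists_bound_of_continuousOn
    Complex.differentiable_one_div_Gamma.continuous.continuousOn
  have hb : ∀ (c : ℂ) (n : ℕ), ‖c‖ + 1 ≤ N → n ≤ N → ‖(Complex.Gamma (c + n))⁻¹‖ ≤ K := by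
    intro c n hc hn
    apply hK
    rw [mem_closedBall_zero_iff]
    have : (n : ℝ) ≤ N := by exact_mod_cast hn
    calc ‖c + n‖ ≤ ‖c‖ + ‖(n : ℂ)‖ := norm_add_le _ _
      _ ≤ 2 * N := by rw [Complex.norm_natCast]; linarith
  refine ⟨max K 0, le_max_right _ _, fun c n hc => ?_⟩
  rcases le_total n N with hn | hn
  · rw [Nat.sub_eq_zero_of_le hn]
    simpa using Or.inl (hb c n hc hn)
  · obtain ⟨m, rfl⟩ := Nat.exists_eq_add_of_le hn
    rw [Nat.add_sub_cancel_left]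
    clear hn
    induction m with
    | zero => simpa using Or.inl (hb c N hc le_rfl)
    | succ m ih =>
      have h0 : (m : ℝ) + 1 ≤ ‖c + (N + m : ℕ)‖ := by
        have := norm_sub_norm_le ((N + m : ℕ) : ℂ) (-c)
        rw [Complex.norm_natCast, norm_neg, sub_neg_eq_add, add_comm _ c] at this
        push_cast at this ⊢
        linarith
      rw [Complex.one_div_Gamma_eq_self_mul_one_div_Gamma_add_one, norm_mul] at ih
      have h1 : ((m : ℝ) + 1) * ‖(Complex.Gamma (c + (N + m : ℕ) + 1))⁻¹‖
          ≤ max K 0 / (m.factorial : ℝ) := le_trans (by gcongr) ih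
      have h2 : c + ((N + (m + 1) : ℕ) : ℂ) = c + (N + m : ℕ) + 1 := by push_cast; ring
      rw [h2, Nat.factorial_succ, le_div_iff₀ (by positivity)]
      rw [le_div_iff₀ (by positivity)] at h1
      push_cast at h1 ⊢
      linarith

/-- The `n!` from the Pochhammer bound cancels the one in `z^n/n!`, and `1/Γ(c+n)` supplies a fresh
factorial. One majorant for all arguments serves both holomorphy in the parameters and termwise
differentiation in `z`. -/
theorem exists_summable_norm_kummerRegTerm_le (R : ℝ) :
    ∃ u : ℕ → ℝ, Summable u ∧ ∀ (a c z : ℂ) (n : ℕ), ‖a‖ ≤ R → ‖c‖ ≤ R → ‖z‖ ≤ R →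
      ‖kummerRegTerm a c z n‖ ≤ u n := by
  obtain ⟨N, hN⟩ := exists_nat_ge (max R 0 + 1)
  have hR : R + 1 ≤ N := le_trans (by gcongr; exact le_max_left _ _) hN
  have hN1 : 1 ≤ N := by
    have : (1 : ℝ) ≤ N := le_trans (by simp) hN
    exact_mod_cast this
  obtain ⟨K, hK0, hK⟩ := exists_norm_inv_Gamma_add_nat_le N
  refine ⟨fun n => K * ((N : ℝ) ^ 2) ^ n / ((n - N).factorial : ℝ), ?_, ?_⟩
  · rw [← summable_nat_add_iff N]
    have := (Real.summable_pow_div_factorial ((N : ℝ) ^ 2)).mul_left (K * ((N : ℝ) ^ 2) ^ N)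
    refine this.congr fun n => ?_
    rw [Nat.add_sub_cancel, pow_add]; ring
  · intro a c z n ha hc hz
    have hfac : (0 : ℝ) < n.factorial := by positivity
    rw [kummerRegTerm, norm_mul, norm_mul, norm_div, norm_pow, Complex.norm_natCast]
    calc _ ≤ ((N : ℝ) ^ n * (n.factorial : ℝ)) * (K / ((n - N).factorial : ℝ)) *
          ((N : ℝ) ^ n / n.factorial) := by
          gcongr
          · exact norm_ascPochhammer_eval_le hN1 (by linarith) n
          · exact hK c n (by linarith)
          · linarith
      _ = K * ((N : ℝ) ^ 2) ^ n / ((n - N).factorial : ℝ) := by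
        rw [← pow_mul, mul_comm 2 n, pow_mul]; field_simp

theorem summable_kummerRegTerm (a c z : ℂ) : Summable (kummerRegTerm a c z) := by
  obtain ⟨u, hu, hb⟩ := exists_summable_norm_kummerRegTerm_le (max ‖a‖ (max ‖c‖ ‖z‖))
  exact hu.of_norm_bounded fun n => hb a c z n (by simp) (by simp) (by simp)

theorem hasSum_kummerReg (a c z : ℂ) : HasSum (kummerRegTerm a c z) (kummerReg a c z) :=
  (summable_kummerRegTerm a c z).hasSum

theorem kummerReg_zero (a c : ℂ) : kummerReg a c 0 = (Complex.Gamma c)⁻¹ := by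
  rw [kummerReg, tsum_eq_single 0]
  · simp [kummerRegTerm]
  · intro n hn; simp [kummerRegTerm, hn]

theorem differentiable_ascPochhammer_eval (n : ℕ) :
    Differentiable ℂ fun a : ℂ => (ascPochhammer ℂ n).eval a :=
  Polynomial.differentiable _

/-- `kummerReg` depends holomorphically on its parameters. -/
theorem Differentiable.kummerReg {f g : ℂ → ℂ} (hf : Differentiable ℂ f)
    (hg : Differentiable ℂ g) (z : ℂ) : Differentiable ℂ fun s => kummerReg (f s) (g s) z := by
  intro s₀
  obtain ⟨A, hA⟩ := (isCompact_closedBall s₀ 1).exists_bound_of_continuousOn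
    hf.continuous.continuousOn
  obtain ⟨B, hB⟩ := (isCompact_closedBall s₀ 1).exists_bound_of_continuousOn
    hg.continuous.continuousOn
  obtain ⟨u, hu, hb⟩ := exists_summable_norm_kummerRegTerm_le (max A (max B ‖z‖))
  have := Complex.differentiableOn_tsum_of_summable_norm (U := Metric.ball s₀ 1)
    (F := fun n s => kummerRegTerm (f s) (g s) z n) hu ?_ Metric.isOpen_ball ?_
  · exact this.differentiableAt (Metric.ball_mem_nhds s₀ one_pos)
  · intro n
    apply Differentiable.differentiableOn
    unfold kummerRegTerm
    exact (((differentiable_ascPochhammer_eval n).comp hf).mul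
      (Complex.differentiable_one_div_Gamma.comp (hg.add_const _))).mul_const _
  · intro n s hs
    have hs' := Metric.ball_subset_closedBall hs
    exact hb _ _ _ n ((hA s hs').trans (by simp)) ((hB s hs').trans (by simp)) (by simp)

theorem ascPochhammer_succ_eval_left (n : ℕ) (a : ℂ) :
    (ascPochhammer ℂ (n + 1)).eval a = a * (ascPochhammer ℂ n).eval (a + 1) := by
  simp [ascPochhammer_succ_left, Polynomial.eval_comp]

theorem hasDerivAt_kummerReg (a c z : ℂ) :
    HasDerivAt (kummerReg a c) (a * kummerReg (a + 1) (c + 1) z) z := by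
  set R := max (‖a‖ + 1) (max (‖c‖ + 1) (‖z‖ + 1)) with hR
  obtain ⟨u, hu, hb⟩ := exists_summable_norm_kummerRegTerm_le R
  let g' : ℕ → ℂ → ℂ := fun n y => (ascPochhammer ℂ n).eval a * (Complex.Gamma (c + n))⁻¹ *
    (n * y ^ (n - 1) / (Nat.factorial n : ℂ))
  have hg' : ∀ n y, g' (n + 1) y = a * kummerRegTerm (a + 1) (c + 1) y n := by
    intro n y
    have h : (c + ((n + 1 : ℕ) : ℂ)) = c + 1 + n := by push_cast; ring
    have h2 : (n : ℂ) + 1 ≠ 0 := by exact_mod_cast n.succ_ne_zero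
    have h3 : (n.factorial : ℂ) ≠ 0 := by exact_mod_cast n.factorial_ne_zero
    simp only [g', kummerRegTerm, ascPochhammer_succ_eval_left, h, Nat.factorial_succ,
      Nat.add_sub_cancel]
    push_cast
    field_simp
  let v : ℕ → ℝ := fun n => if n = 0 then 0 else ‖a‖ * u (n - 1)
  have hv : Summable v := by
    rw [← summable_nat_add_iff 1]
    simpa [v] using hu.mul_left ‖a‖
  have key := hasDerivAt_tsum_of_isPreconnected (g := fun n y => kummerRegTerm a c y n)
    (g' := g') (t := Metric.ball (0 : ℂ) (‖z‖ + 1)) (y₀ := z) (y := z) hv Metric.isOpen_ball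
    (convex_ball _ _).isPreconnected ?_ ?_ (by simp) (summable_kummerRegTerm a c z) (by simp)
  · have h0 : ∑' n, g' n z = a * kummerReg (a + 1) (c + 1) z := by
      have hs : HasSum (fun n => g' (n + 1) z) (a * kummerReg (a + 1) (c + 1) z) := by
        simpa only [hg'] using (hasSum_kummerReg (a + 1) (c + 1) z).mul_left a
      have := (hasSum_nat_add_iff (f := fun n => g' n z) 1).1 hs
      rw [this.tsum_eq]
      simp [g']
    rw [← h0]; exact key
  · intro n y _
    simp only [kummerRegTerm, g']
    exact ((hasDerivAt_pow n y).div_const _).const_mul _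
  · intro n y hy
    rw [mem_ball_zero_iff] at hy
    cases n with
    | zero => simp [v, g']
    | succ n =>
      rw [hg', norm_mul]
      simp only [v, Nat.add_one_ne_zero, if_false, Nat.add_sub_cancel]
      gcongr
      apply hb
      · exact (norm_add_le _ _).trans (by simp [hR])
      · exact (norm_add_le _ _).trans (by simp [hR])
      · exact hy.le.trans (by simp [hR])

theorem continuous_kummerReg (a c : ℂ) : Continuous (kummerReg a c) :=
  continuous_iff_continuousAt.2 fun z => (hasDerivAt_kummerReg a c z).continuousAt

/-! ### Differential equations and contiguous relations, by comparing coefficients -/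

/-- The series of `z ↦ z * kummerReg a c z`. -/
theorem hasSum_mul_kummerReg (a c z : ℂ) :
    HasSum (fun n : ℕ => (n : ℂ) * (ascPochhammer ℂ (n - 1)).eval a *
      (Complex.Gamma (c + n - 1))⁻¹ * (z ^ n / (Nat.factorial n : ℂ))) (z * kummerReg a c z) := by
  set F : ℕ → ℂ := fun n : ℕ => (n : ℂ) * (ascPochhammer ℂ (n - 1)).eval a *
      (Complex.Gamma (c + n - 1))⁻¹ * (z ^ n / (Nat.factorial n : ℂ)) with hF
  have hn : ∀ n, F (n + 1) = z * kummerRegTerm a c z n := by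
    intro n
    have h : (c + ((n + 1 : ℕ) : ℂ) - 1) = c + n := by push_cast; ring
    have h2 : (n : ℂ) + 1 ≠ 0 := by exact_mod_cast n.succ_ne_zero
    have h3 : (n.factorial : ℂ) ≠ 0 := by exact_mod_cast n.factorial_ne_zero
    simp only [hF]
    rw [h, kummerRegTerm, Nat.factorial_succ, Nat.add_sub_cancel]
    push_cast
    field_simp
    ring
  have h : HasSum (fun n => F (n + 1)) (z * kummerReg a c z) := by
    simpa only [hn] using (hasSum_kummerReg a c z).mul_left z
  have h0 : z * kummerReg a c z + ∑ i ∈ Finset.range 1, F i = z * kummerReg a c z := by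
    simp [hF]
  exact h0 ▸ (hasSum_nat_add_iff (f := F) 1).1 h

/-- Kummer's differential equation for `kummerReg`, up to the factor `a`. -/
theorem kummerReg_ode (a c z : ℂ) :
    z * ((a + 1) * kummerReg (a + 2) (c + 2) z) + (c - z) * kummerReg (a + 1) (c + 1) z
      = kummerReg a c z := by
  have h := (((hasSum_mul_kummerReg (a + 2) (c + 2) z).mul_left (a + 1)).add
    ((hasSum_kummerReg (a + 1) (c + 1) z).mul_left c)).sub (hasSum_mul_kummerReg (a + 1) (c + 1) z)
  have h' := h.unique ((hasSum_kummerReg a c z).congr_fun ?_)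
  · linear_combination h'
  intro n
  have hG := Complex.one_div_Gamma_eq_self_mul_one_div_Gamma_add_one (c + n)
  have e1 : c + 2 + n - 1 = c + n + 1 := by ring
  have e2 : c + 1 + n = c + n + 1 := by ring
  have e3 : c + n + 1 - 1 = c + n := by ring
  simp only [kummerRegTerm, e1, e2, e3, hG]
  cases n with
  | zero => simp
  | succ n =>
    rw [Nat.add_sub_cancel, ascPochhammer_succ_eval_left n a, ascPochhammer_succ_eval n (a + 1)]
    have := ascPochhammer_succ_eval_left n (a + 1)
    rw [ascPochhammer_succ_eval, show a + 1 + 1 = a + 2 by ring] at this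
    push_cast at this ⊢
    linear_combination -(n + 1) * (Complex.Gamma (c + (n + 1) + 1))⁻¹ * (z ^ (n + 1) / ((n + 1).factorial : ℂ)) * this

/-- Coefficientwise this is `(c-1+n)/Γ(c+n) = 1/Γ(c-1+n)`. It makes differentiating `z^(c-1) *
kummerReg a c z` amount to lowering `c` by one. -/
theorem kummerReg_lower (a c z : ℂ) :
    (c - 1) * kummerReg a c z + z * (a * kummerReg (a + 1) (c + 1) z) = kummerReg a (c - 1) z := by
  have h := ((hasSum_kummerReg a c z).mul_left (c - 1)).add
    ((hasSum_mul_kummerReg (a + 1) (c + 1) z).mul_left a)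
  have h' := h.unique ((hasSum_kummerReg a (c - 1) z).congr_fun ?_)
  · linear_combination h'
  intro n
  have hG := Complex.one_div_Gamma_eq_self_mul_one_div_Gamma_add_one (c - 1 + n)
  have e1 : c - 1 + n + 1 = c + n := by ring
  have e2 : c + 1 + n - 1 = c + n := by ring
  rw [e1] at hG
  simp only [kummerRegTerm, e2, hG]
  cases n with
  | zero => simp
  | succ n =>
    rw [Nat.add_sub_cancel, ascPochhammer_succ_eval_left n a]
    push_cast
    ring

/-- With `c = 2 - β` and `a = α - β + 1`, this is Kummer's equation for the second Frobenius
solution `t^(1-β) * kummerReg a (2-β) t`, stripped of its power of `t`. -/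
theorem kummerReg_ode_second (a c z : ℂ) :
    kummerReg a (c - 2) z + (2 - c - z) * kummerReg a (c - 1) z
      - (a - c + 1) * (z * kummerReg a c z) = 0 := by
  have h := (((hasSum_kummerReg a (c - 2) z).add
    ((hasSum_kummerReg a (c - 1) z).mul_left (2 - c))).sub
    (hasSum_mul_kummerReg a (c - 1) z)).sub ((hasSum_mul_kummerReg a c z).mul_left (a - c + 1))
  have h' := h.unique (hasSum_zero.congr_fun ?_)
  · linear_combination h'
  intro n
  have hG := Complex.one_div_Gamma_eq_self_mul_one_div_Gamma_add_one (c - 2 + n)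
  have e1 : c - 2 + n + 1 = c + n - 1 := by ring
  have e2 : c - 1 + n = c + n - 1 := by ring
  have e3 : c + n - 1 - 1 = c - 2 + n := by ring
  rw [e1] at hG
  simp only [kummerRegTerm, e2, e3, hG]
  cases n with
  | zero => simp; ring
  | succ n =>
    rw [Nat.add_sub_cancel, ascPochhammer_succ_eval n a]
    push_cast
    ring

/-- The three-term contiguous relation in the upper parameter. -/
theorem kummerReg_contiguous (a c z : ℂ) :
    (c - a) * kummerReg (a - 1) c z + (2 * a - c + z) * kummerReg a c z
      - a * kummerReg (a + 1) c z = 0 := by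
  have h := ((((hasSum_kummerReg (a - 1) c z).mul_left (c - a)).add
    ((hasSum_kummerReg a c z).mul_left (2 * a - c))).add
    (hasSum_mul_kummerReg a c z)).sub ((hasSum_kummerReg (a + 1) c z).mul_left a)
  have h' := h.unique (hasSum_zero.congr_fun ?_)
  · linear_combination h'
  intro n
  have hG := Complex.one_div_Gamma_eq_self_mul_one_div_Gamma_add_one (c + n - 1)
  rw [sub_add_cancel] at hG
  simp only [kummerRegTerm, hG]
  cases n with
  | zero => simp; ring
  | succ n =>
    have h1 := ascPochhammer_succ_eval_left n (a - 1)
    have h2 := ascPochhammer_succ_eval_left (n + 1) a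
    rw [sub_add_cancel] at h1
    rw [ascPochhammer_succ_eval, ascPochhammer_succ_eval] at h2
    rw [Nat.add_sub_cancel, h1, ascPochhammer_succ_eval n a]
    push_cast at h2 ⊢
    linear_combination (Complex.Gamma (c + (n + 1)))⁻¹ * (z ^ (n + 1) / ((n + 1).factorial : ℂ)) * h2

theorem kummerF_eq_Gamma_mul_kummerReg (a : ℂ) {c : ℂ} (hc : ∀ k : ℕ, c ≠ -k) (z : ℂ) :
    kummerF a c z = Complex.Gamma c * kummerReg a c z := by
  rw [kummerF, kummerReg, ← tsum_mul_left]
  congr 1 with n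
  rw [← Complex.Gamma_add_nat_div_Gamma_eq c hc, kummerRegTerm]
  have := Complex.Gamma_ne_zero hc
  field_simp

/-! ### Tricomi's integral -/

theorem Complex.cpow_add_one_of_ne_zero {z : ℂ} (hz : z ≠ 0) (s : ℂ) :
    z ^ (s + 1) = z ^ s * z := by
  rw [Complex.cpow_add _ _ hz, Complex.cpow_one]

/-- The integrand of Tricomi's integral. -/
noncomputable def tricomiIntegrand (α γ : ℂ) (t u : ℝ) : ℂ :=
  (u : ℂ) ^ (α - 1) * (1 + u : ℂ) ^ γ * Complex.exp (-(t * u))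

/-- Tricomi's integral `∫₀^∞ u^(α-1) (1+u)^γ e^(-tu) du`, equal to `Γ(α) U(α, α+γ+1, t)`. -/
noncomputable def tricomiIntegral (α γ : ℂ) (t : ℝ) : ℂ :=
  ∫ u in Set.Ioi (0 : ℝ), tricomiIntegrand α γ t u

theorem norm_one_add_ofReal_cpow {u : ℝ} (hu : 0 < u) (γ : ℂ) :
    ‖(1 + u : ℂ) ^ γ‖ = (1 + u) ^ γ.re := by
  rw [← Complex.norm_cpow_eq_rpow_re_of_pos (by linarith)]
  push_cast; rfl

theorem norm_tricomiIntegrand {u : ℝ} (hu : 0 < u) (α γ : ℂ) (t : ℝ) :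
    ‖tricomiIntegrand α γ t u‖ = u ^ (α.re - 1) * (1 + u) ^ γ.re * Real.exp (-(t * u)) := by
  rw [tricomiIntegrand, norm_mul, norm_mul, norm_one_add_ofReal_cpow hu,
    Complex.norm_cpow_eq_rpow_re_of_pos hu, Complex.norm_exp]
  simp

theorem measurable_tricomiIntegrand (α γ : ℂ) (t : ℝ) : Measurable (tricomiIntegrand α γ t) := by
  unfold tricomiIntegrand
  fun_prop

theorem integrableOn_rpow_mul_exp_neg {s r : ℝ} (hs : 0 < s) (hr : 0 < r) :
    IntegrableOn (fun x : ℝ => x ^ (s - 1) * Real.exp (-(r * x))) (Set.Ioi 0) := by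
  simpa using integrableOn_rpow_mul_exp_neg_mul_rpow (s := s - 1) (by linarith) one_pos hr

theorem integrableOn_cpow_mul_exp_neg {s : ℂ} {r : ℝ} (hs : 0 < s.re) (hr : 0 < r) :
    IntegrableOn (fun x : ℝ => (x : ℂ) ^ (s - 1) * Complex.exp (-(r * x))) (Set.Ioi 0) := by
  refine (integrableOn_rpow_mul_exp_neg hs hr).mono' (by fun_prop) ?_
  filter_upwards [ae_restrict_mem measurableSet_Ioi] with x hx
  rw [norm_mul, Complex.norm_cpow_eq_rpow_re_of_pos hx, Complex.norm_exp]
  simp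

/-- Half of the exponential decay is spent on `(1+u)^g`: one term of the exponential series gives
`(1+u)^n ≤ n! (2/t)^n e^(t(1+u)/2)`. -/
theorem integrableOn_rpow_mul_one_add_rpow_mul_exp_neg {A g t : ℝ} (hA : 0 < A) (ht : 0 < t) :
    IntegrableOn (fun u : ℝ => u ^ (A - 1) * (1 + u) ^ g * Real.exp (-(t * u))) (Set.Ioi 0) := by
  obtain ⟨n, hn⟩ := exists_nat_ge g
  have hb := (integrableOn_rpow_mul_exp_neg hA (half_pos ht)).const_mul
    (n.factorial * (2 / t) ^ n * Real.exp (t / 2))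
  refine hb.mono' (by fun_prop) ?_
  filter_upwards [ae_restrict_mem measurableSet_Ioi] with u hu
  have hu' : 0 < u := hu
  have h1 : (1 + u) ^ g ≤ (1 + u) ^ n := by
    rw [← Real.rpow_natCast]
    exact Real.rpow_le_rpow_of_exponent_le (by linarith) hn
  have h2 : (1 + u) ^ n ≤ n.factorial * (2 / t) ^ n * Real.exp (t / 2 * (1 + u)) := by
    have := Real.pow_div_factorial_le_exp (t / 2 * (1 + u)) (by positivity) n
    rw [div_le_iff₀ (by positivity), mul_pow] at this
    calc (1 + u) ^ n = (2 / t) ^ n * ((t / 2) ^ n * (1 + u) ^ n) := by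
          rw [← mul_assoc, ← mul_pow]; field_simp; simp
      _ ≤ (2 / t) ^ n * (Real.exp (t / 2 * (1 + u)) * n.factorial) := by gcongr
      _ = _ := by ring
  rw [Real.norm_of_nonneg (by positivity)]
  calc u ^ (A - 1) * (1 + u) ^ g * Real.exp (-(t * u))
      ≤ u ^ (A - 1) * (n.factorial * (2 / t) ^ n * Real.exp (t / 2 * (1 + u))) *
        Real.exp (-(t * u)) := by gcongr; exact h1.trans h2
    _ = n.factorial * (2 / t) ^ n * u ^ (A - 1) *
        (Real.exp (t / 2 * (1 + u)) * Real.exp (-(t * u))) := by ring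
    _ = n.factorial * (2 / t) ^ n * u ^ (A - 1) *
        (Real.exp (t / 2) * Real.exp (-(t / 2 * u))) := by
        rw [← Real.exp_add, ← Real.exp_add]; ring_nf
    _ = _ := by ring

theorem integrableOn_tricomiIntegrand {α : ℂ} (hα : 0 < α.re) (γ : ℂ) {t : ℝ} (ht : 0 < t) :
    IntegrableOn (tricomiIntegrand α γ t) (Set.Ioi 0) := by
  refine (integrableOn_rpow_mul_one_add_rpow_mul_exp_neg (g := γ.re) hα ht).mono'
    (measurable_tricomiIntegrand α γ t).aestronglyMeasurable ?_
  filter_upwards [ae_restrict_mem measurableSet_Ioi] with u hu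
  rw [norm_tricomiIntegrand hu]

theorem one_add_ofReal_ne_zero {u : ℝ} (hu : 0 < u) : (1 + u : ℂ) ≠ 0 := by
  have : (1 + u : ℝ) ≠ 0 := by positivity
  exact_mod_cast this

/-- Tricomi's integral depends continuously on its parameters. -/
theorem continuousAt_tricomiIntegral {f g : ℂ → ℂ} {s₀ : ℂ} (hf : ContinuousAt f s₀)
    (hg : ContinuousAt g s₀) (h0 : 0 < (f s₀).re) {t : ℝ} (ht : 0 < t) :
    ContinuousAt (fun s => tricomiIntegral (f s) (g s) t) s₀ := by
  have hfre : ContinuousAt (fun s => (f s).re) s₀ := Complex.continuous_re.continuousAt.comp hf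
  have hgre : ContinuousAt (fun s => (g s).re) s₀ := Complex.continuous_re.continuousAt.comp hg
  have e1 : ∀ᶠ s in 𝓝 s₀, (f s₀).re / 2 < (f s).re :=
    hfre.eventually_const_lt (by linarith)
  have e2 : ∀ᶠ s in 𝓝 s₀, (f s).re < (f s₀).re + 1 := hfre.eventually_lt_const (by linarith)
  have e3 : ∀ᶠ s in 𝓝 s₀, (g s).re < (g s₀).re + 1 := hgre.eventually_lt_const (by linarith)
  -- The exponent of `u` varies between two bounds: the lower one dominates for `u ≤ 1`, the upper
  -- one for `u ≥ 1`, and the majorant is the sum of both.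
  have i1 := integrableOn_rpow_mul_one_add_rpow_mul_exp_neg (g := (g s₀).re + 1)
    (half_pos h0) ht
  have i2 := integrableOn_rpow_mul_one_add_rpow_mul_exp_neg (g := (g s₀).re + 1)
    (A := (f s₀).re + 1) (by linarith) ht
  refine continuousAt_of_dominated (bound := _) ?_ ?_ (i1.add i2) ?_
  · exact Eventually.of_forall fun s => (measurable_tricomiIntegrand _ _ t).aestronglyMeasurable
  · filter_upwards [e1, e2, e3] with s h1 h2 h3
    filter_upwards [ae_restrict_mem measurableSet_Ioi] with u hu
    have hu' : 0 < u := hu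
    rw [norm_tricomiIntegrand hu]
    simp only [Pi.add_apply]
    rw [← add_mul, ← add_mul]
    gcongr ?_ * ?_ * _
    · rcases le_total u 1 with h | h
      · have := Real.rpow_le_rpow_of_exponent_ge hu' h
          (by linarith : (f s₀).re / 2 - 1 ≤ (f s).re - 1)
        have h' : 0 ≤ u ^ ((f s₀).re + 1 - 1) := by positivity
        linarith
      · have := Real.rpow_le_rpow_of_exponent_le h
          (by linarith : (f s).re - 1 ≤ (f s₀).re + 1 - 1)
        have h' : 0 ≤ u ^ ((f s₀).re / 2 - 1) := by positivity
        linarith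
    · exact Real.rpow_le_rpow_of_exponent_le (by linarith) h3.le
  · filter_upwards [ae_restrict_mem measurableSet_Ioi] with u hu
    have hu0 : (u : ℂ) ≠ 0 := by exact_mod_cast (ne_of_gt hu)
    unfold tricomiIntegrand
    exact (((hf.sub continuousAt_const).const_cpow (Or.inl hu0)).mul
      (hg.const_cpow (Or.inl (one_add_ofReal_ne_zero hu)))).mul continuousAt_const

theorem differentiable_tricomiIntegral {α : ℂ} (hα : 0 < α.re) {t : ℝ} (ht : 0 < t) :
    Differentiable ℂ fun γ => tricomiIntegral α γ t := by
  intro γ₀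
  refine (hasDerivAt_integral_of_dominated_loc_of_deriv_le (μ := volume.restrict (Set.Ioi 0))
    (F := fun γ u => tricomiIntegrand α γ t u)
    (F' := fun γ u => tricomiIntegrand α γ t u * Complex.log (1 + u))
    (Metric.ball_mem_nhds γ₀ one_pos) ?_
    (integrableOn_tricomiIntegrand hα γ₀ ht) ?_ ?_
    -- One unit of the `2` comes from the radius of the ball around `γ₀`, the other from `|log(1+u)|
    -- ≤ 1+u`.
    (integrableOn_rpow_mul_one_add_rpow_mul_exp_neg (g := γ₀.re + 2) hα ht) ?_).2.differentiableAt
  · exact Eventually.of_forall fun s => (measurable_tricomiIntegrand _ _ t).aestronglyMeasurable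
  · exact ((measurable_tricomiIntegrand _ _ t).mul (by fun_prop)).aestronglyMeasurable
  · filter_upwards [ae_restrict_mem measurableSet_Ioi] with u hu γ hγ
    have hu' : 0 < u := hu
    rw [norm_mul, norm_tricomiIntegrand hu]
    have h1 : ‖Complex.log (1 + u)‖ ≤ 1 + u := by
      rw [show (1 + u : ℂ) = ((1 + u : ℝ) : ℂ) by push_cast; rfl, ← Complex.ofReal_log
        (by linarith), Complex.norm_real, Real.norm_of_nonneg (Real.log_nonneg (by linarith))]
      exact (Real.log_le_sub_one_of_pos (by linarith)).trans (by linarith)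
    have h2 : γ.re ≤ γ₀.re + 1 := by
      rw [Metric.mem_ball, dist_eq_norm] at hγ
      have := (Complex.abs_re_le_norm (γ - γ₀)).trans hγ.le
      rw [Complex.sub_re] at this
      linarith [le_abs_self (γ.re - γ₀.re)]
    have h3 : (1 + u) ^ γ.re ≤ (1 + u) ^ (γ₀.re + 1) :=
      Real.rpow_le_rpow_of_exponent_le (by linarith) h2
    calc _ ≤ u ^ (α.re - 1) * (1 + u) ^ (γ₀.re + 1) * Real.exp (-(t * u)) * (1 + u) := by gcongr
      _ = u ^ (α.re - 1) * ((1 + u) ^ (γ₀.re + 1) * (1 + u)) * Real.exp (-(t * u)) := by ring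
      _ = _ := by
        rw [← Real.rpow_add_one (by positivity)]; ring_nf
  · filter_upwards [ae_restrict_mem measurableSet_Ioi] with u hu γ hγ
    unfold tricomiIntegrand
    refine HasDerivAt.congr_deriv ((((hasDerivAt_id γ).const_cpow (c := (1 + u : ℂ))
      (Or.inl (one_add_ofReal_ne_zero hu))).const_mul ((u : ℂ) ^ (α - 1))).mul_const
      (Complex.exp (-(t * u)))) ?_
    simp only [id]
    ring

theorem mul_tricomiIntegrand {u : ℝ} (hu : 0 < u) (α γ : ℂ) (t : ℝ) :
    (u : ℂ) * tricomiIntegrand α γ t u = tricomiIntegrand (α + 1) γ t u := by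
  have hu0 : (u : ℂ) ≠ 0 := by exact_mod_cast hu.ne'
  rw [tricomiIntegrand, tricomiIntegrand, show α + 1 - 1 = α - 1 + 1 by ring,
    Complex.cpow_add_one_of_ne_zero hu0]
  ring

theorem hasDerivAt_tricomiIntegral {α : ℂ} (hα : 0 < α.re) (γ : ℂ) {t : ℝ} (ht : 0 < t) :
    HasDerivAt (tricomiIntegral α γ) (-tricomiIntegral (α + 1) γ t) t := by
  have key := (hasDerivAt_integral_of_dominated_loc_of_deriv_le (μ := volume.restrict (Set.Ioi 0))
    (F := fun t u => tricomiIntegrand α γ t u)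
    (F' := fun t u => -tricomiIntegrand (α + 1) γ t u)
    (Ioi_mem_nhds (half_lt_self ht)) ?_
    (integrableOn_tricomiIntegrand hα γ ht) ?_ ?_
    (integrableOn_rpow_mul_one_add_rpow_mul_exp_neg (A := α.re + 1) (g := γ.re)
      (by linarith) (half_pos ht)) ?_).2
  · rw [integral_neg] at key
    exact key
  · exact Eventually.of_forall fun s => (measurable_tricomiIntegrand _ _ _).aestronglyMeasurable
  · exact (measurable_tricomiIntegrand _ _ t).neg.aestronglyMeasurable
  · filter_upwards [ae_restrict_mem measurableSet_Ioi] with u hu s hs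
    have hu' : 0 < u := hu
    have hs' : t / 2 < s := hs
    rw [norm_neg, norm_tricomiIntegrand hu]
    simp only [Complex.add_re, Complex.one_re]
    gcongr
  · filter_upwards [ae_restrict_mem measurableSet_Ioi] with u hu s hs
    rw [← mul_tricomiIntegrand hu]
    unfold tricomiIntegrand
    have h1 : HasDerivAt (fun s : ℝ => Complex.exp (-(s * u)))
        (Complex.exp (-(s * u)) * -(1 * u)) s :=
      ((((hasDerivAt_id (s : ℂ)).mul_const (u : ℂ)).neg).cexp).comp_ofReal
    refine (h1.const_mul ((u : ℂ) ^ (α - 1) * (1 + u : ℂ) ^ γ)).congr_deriv ?_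
    ring

/-- Kummer's differential equation for Tricomi's integral. -/
theorem tricomiIntegral_ode {α : ℂ} (hα : 0 < α.re) (γ : ℂ) {t : ℝ} (ht : 0 < t) :
    t * tricomiIntegral (α + 2) γ t - (α + γ + 1 - t) * tricomiIntegral (α + 1) γ t
      - α * tricomiIntegral α γ t = 0 := by
  have hα1 : 0 < (α + 1).re := by rw [Complex.add_re, Complex.one_re]; linarith
  have hα2 : 0 < (α + 2).re := by simp; linarith
  have hα0 : α ≠ 0 := by rintro rfl; simp at hα
  have i0 := integrableOn_tricomiIntegrand hα γ ht
  have i1 := integrableOn_tricomiIntegrand hα1 γ ht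
  have i2 := integrableOn_tricomiIntegrand hα2 γ ht
  have iF := integrableOn_tricomiIntegrand hα1 (γ + 1) ht
  have hF' : IntegrableOn (fun u => (-(t : ℂ)) * tricomiIntegrand (α + 2) γ t u +
      (α + γ + 1 - t) * tricomiIntegrand (α + 1) γ t u + α * tricomiIntegrand α γ t u)
      (Set.Ioi 0) := ((i2.const_mul _).add (i1.const_mul _)).add (i0.const_mul _)
  -- The equation is the integral of the total derivative of `u^α (1+u)^(γ+1) e^(-tu)`, which
  -- vanishes at `0` since `Re α > 0`, and at infinity since it and its derivative are integrable.
  have hderiv : ∀ u ∈ Set.Ioi (0 : ℝ), HasDerivAt (tricomiIntegrand (α + 1) (γ + 1) t)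
      ((-(t : ℂ)) * tricomiIntegrand (α + 2) γ t u +
      (α + γ + 1 - t) * tricomiIntegrand (α + 1) γ t u + α * tricomiIntegrand α γ t u) u := by
    intro u hu
    have hu' : 0 < u := hu
    rw [show α + 2 = α + 1 + 1 by ring, ← mul_tricomiIntegrand hu (α + 1),
      ← mul_tricomiIntegrand hu α]
    unfold tricomiIntegrand
    have h1 : HasDerivAt (fun u : ℝ => (u : ℂ) ^ (α + 1 - 1))
        ((α + 1 - 1) * (u : ℂ) ^ (α + 1 - 1 - 1) * 1) u :=
      ((hasDerivAt_id (u : ℂ)).cpow_const (Or.inl (by simpa using hu'))).comp_ofReal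
    have h2 : HasDerivAt (fun u : ℝ => (1 + u : ℂ) ^ (γ + 1))
        ((γ + 1) * (1 + u : ℂ) ^ (γ + 1 - 1) * 1) u :=
      (((hasDerivAt_id (u : ℂ)).const_add 1).cpow_const
        (Or.inl (by simp; linarith))).comp_ofReal
    have h3 : HasDerivAt (fun u : ℝ => Complex.exp (-(t * u)))
        (Complex.exp (-(t * u)) * -(t * 1)) u :=
      ((((hasDerivAt_id (u : ℂ)).const_mul (t : ℂ)).neg).cexp).comp_ofReal
    have hu0 : (u : ℂ) ≠ 0 := by exact_mod_cast hu'.ne'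
    refine ((h1.mul h2).mul h3).congr_deriv ?_
    have e1 : (u : ℂ) ^ (α + 1 - 1) = (u : ℂ) ^ (α - 1) * u := by
      rw [← Complex.cpow_add_one_of_ne_zero hu0]; ring_nf
    have e2 : (1 + u : ℂ) ^ (γ + 1) = (1 + u : ℂ) ^ γ * (1 + u) := by
      rw [← Complex.cpow_add_one_of_ne_zero (one_add_ofReal_ne_zero hu)]
    rw [add_sub_cancel_right] at e1
    simp only [Pi.mul_apply, add_sub_cancel_right, e1, e2]
    ring
  have hcont : ContinuousWithinAt (tricomiIntegrand (α + 1) (γ + 1) t) (Set.Ici 0) 0 := by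
    apply ContinuousAt.continuousWithinAt
    unfold tricomiIntegrand
    refine (ContinuousAt.mul ?_ ?_).mul (by fun_prop)
    · rw [add_sub_cancel_right]
      exact (Complex.continuous_ofReal_cpow_const hα).continuousAt
    · exact ContinuousAt.cpow (by fun_prop) continuousAt_const (by simp)
  have h := integral_Ioi_of_hasDerivAt_of_tendsto hcont hderiv hF'
    (tendsto_zero_of_hasDerivAt_of_integrableOn_Ioi hderiv hF' iF)
  have h0 : tricomiIntegrand (α + 1) (γ + 1) t 0 = 0 := by
    simp [tricomiIntegrand, hα0]
  have i21 : IntegrableOn (fun u => (-(t : ℂ)) * tricomiIntegrand (α + 2) γ t u +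
      (α + γ + 1 - t) * tricomiIntegrand (α + 1) γ t u) (Set.Ioi 0) :=
    (i2.const_mul _).add (i1.const_mul _)
  rw [integral_add i21 (i0.const_mul _),
    integral_add (i2.const_mul _) (i1.const_mul _), integral_const_mul, integral_const_mul,
    integral_const_mul, h0] at h
  unfold tricomiIntegral
  linear_combination -h

/-! ### The beta integral on the half line -/

theorem one_div_ofReal_cpow {r : ℝ} (hr : 0 < r) (s : ℂ) :
    (1 / (r : ℂ)) ^ s = (r : ℂ) ^ (-s) := by
  rw [one_div, Complex.inv_cpow, Complex.cpow_neg]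
  rw [Complex.arg_ofReal_of_nonneg hr.le]
  exact Real.pi_pos.ne

/-- The beta integral over the half line: integrability and value. -/
theorem integrableOn_and_integral_cpow_mul_one_add_cpow {a b : ℂ} (ha : 0 < a.re) (hb : 0 < b.re) :
    IntegrableOn (fun u : ℝ => (u : ℂ) ^ (a - 1) * (1 + u : ℂ) ^ (-(a + b))) (Set.Ioi 0) ∧
    ∫ u in Set.Ioi (0 : ℝ), (u : ℂ) ^ (a - 1) * (1 + u : ℂ) ^ (-(a + b)) =
      Complex.Gamma a * Complex.Gamma b / Complex.Gamma (a + b) := by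
  have hab : 0 < (a + b).re := by rw [Complex.add_re]; linarith
  have hG : Complex.Gamma (a + b) ≠ 0 := Complex.Gamma_ne_zero_of_re_pos hab
  -- Integrating in `u` first gives `Γ(a) Γ(b)`; integrating in `x` first gives `Γ(a+b)` times the
  -- beta integral.
  let F : ℝ → ℝ → ℂ := fun x u => (x : ℂ) ^ (a + b - 1) * Complex.exp (-x) *
    ((u : ℂ) ^ (a - 1) * Complex.exp (-(x * u)))
  have hmeas : AEStronglyMeasurable (Function.uncurry F)
      ((volume.restrict (Set.Ioi 0)).prod (volume.restrict (Set.Ioi 0))) := by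
    apply Measurable.aestronglyMeasurable
    unfold F Function.uncurry
    fun_prop
  have hint : Integrable (Function.uncurry F)
      ((volume.restrict (Set.Ioi 0)).prod (volume.restrict (Set.Ioi 0))) := by
    rw [integrable_prod_iff hmeas]
    constructor
    · filter_upwards [ae_restrict_mem measurableSet_Ioi] with x hx
      exact (integrableOn_cpow_mul_exp_neg ha hx).const_mul
        ((x : ℂ) ^ (a + b - 1) * Complex.exp (-x))
    · have := (integrableOn_rpow_mul_exp_neg hb one_pos).const_mul (Real.Gamma a.re)
      refine IntegrableOn.congr_fun this (fun x hx => ?_) measurableSet_Ioi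
      have hx' : 0 < x := hx
      have e : ∀ u ∈ Set.Ioi (0 : ℝ), ‖Function.uncurry F (x, u)‖ =
          x ^ (a.re + b.re - 1) * Real.exp (-x) * (u ^ (a.re - 1) * Real.exp (-(x * u))) := by
        intro u hu
        simp only [F, Function.uncurry, norm_mul, Complex.norm_cpow_eq_rpow_re_of_pos hx,
          Complex.norm_cpow_eq_rpow_re_of_pos hu, Complex.norm_exp]
        simp
      rw [setIntegral_congr_fun measurableSet_Ioi e, integral_const_mul,
        Real.integral_rpow_mul_exp_neg_mul_Ioi ha hx', one_div, Real.inv_rpow hx'.le,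
        show a.re + b.re - 1 = (b.re - 1) + a.re by ring, Real.rpow_add hx', one_mul]
      have : x ^ a.re ≠ 0 := by positivity
      field_simp
  have hx : ∀ x ∈ Set.Ioi (0 : ℝ), ∫ u in Set.Ioi (0 : ℝ), F x u =
      Complex.Gamma a * ((x : ℂ) ^ (b - 1) * Complex.exp (-((1 : ℝ) * x))) := by
    intro x hx
    have hx' : 0 < x := hx
    have hx0 : (x : ℂ) ≠ 0 := by exact_mod_cast hx'.ne'
    simp only [F]
    rw [integral_const_mul, Complex.integral_cpow_mul_exp_neg_mul_Ioi ha hx',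
      one_div_ofReal_cpow hx', show b - 1 = (a + b - 1) + -a by ring, Complex.cpow_add _ _ hx0]
    push_cast
    ring_nf
  have hu : ∀ u ∈ Set.Ioi (0 : ℝ), ∫ x in Set.Ioi (0 : ℝ), F x u =
      Complex.Gamma (a + b) * ((u : ℂ) ^ (a - 1) * (1 + u : ℂ) ^ (-(a + b))) := by
    intro u hu
    have hu' : 0 < 1 + u := by have : 0 < u := hu; linarith
    have e : ∀ x ∈ Set.Ioi (0 : ℝ), F x u = (u : ℂ) ^ (a - 1) *
        ((x : ℂ) ^ (a + b - 1) * Complex.exp (-((1 + u : ℝ) * x))) := by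
      intro x _
      have : Complex.exp (-((1 + u : ℝ) * x)) = Complex.exp (-x) * Complex.exp (-(x * u)) := by
        rw [← Complex.exp_add]; push_cast; ring_nf
      simp only [F, this]
      ring
    rw [setIntegral_congr_fun measurableSet_Ioi e, integral_const_mul,
      Complex.integral_cpow_mul_exp_neg_mul_Ioi hab hu', one_div_ofReal_cpow hu']
    push_cast
    ring
  constructor
  · have := (hint.integral_prod_right).const_mul (Complex.Gamma (a + b))⁻¹
    refine IntegrableOn.congr_fun this (fun u hu' => ?_) measurableSet_Ioi
    have h := hu u hu'
    simp only [Function.uncurry]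
    rw [h, inv_mul_cancel_left₀ hG]
  · have h := integral_integral_swap hint
    rw [setIntegral_congr_fun measurableSet_Ioi hx, setIntegral_congr_fun measurableSet_Ioi hu,
      integral_const_mul, integral_const_mul,
      Complex.integral_cpow_mul_exp_neg_mul_Ioi hb one_pos] at h
    rw [eq_div_iff hG]
    rw [Complex.ofReal_one, div_one, Complex.one_cpow, one_mul] at h
    linear_combination -h

/-! ### Wronskians and the connection formula -/

/-- **Abel's identity** for Kummer's equation `t y'' + (β - t) y' - α y = 0`: the weighted Wronskian
of two solutions equals its limit at `0`. -/
theorem kummer_wronskian_eq {α β L : ℂ} {y y' y'' z z' z'' : ℝ → ℂ}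
    (hy : ∀ t : ℝ, 0 < t → HasDerivAt y (y' t) t) (hy' : ∀ t : ℝ, 0 < t → HasDerivAt y' (y'' t) t)
    (hz : ∀ t : ℝ, 0 < t → HasDerivAt z (z' t) t) (hz' : ∀ t : ℝ, 0 < t → HasDerivAt z' (z'' t) t)
    (hyode : ∀ t : ℝ, 0 < t → t * y'' t + (β - t) * y' t - α * y t = 0)
    (hzode : ∀ t : ℝ, 0 < t → t * z'' t + (β - t) * z' t - α * z t = 0)
    (hL : Tendsto (fun t : ℝ => (t : ℂ) ^ β * Complex.exp (-t) * (y t * z' t - y' t * z t))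
      (𝓝[>] 0) (𝓝 L)) {t : ℝ} (ht : 0 < t) :
    (t : ℂ) ^ β * Complex.exp (-t) * (y t * z' t - y' t * z t) = L := by
  set w : ℝ → ℂ := fun t => (t : ℂ) ^ β * Complex.exp (-t) * (y t * z' t - y' t * z t) with hw
  have hd : ∀ s : ℝ, 0 < s → HasDerivAt w 0 s := by
    intro s hs
    have hs0 : (s : ℂ) ≠ 0 := by exact_mod_cast hs.ne'
    have h1 : HasDerivAt (fun u : ℝ => (u : ℂ) ^ β) (β * (s : ℂ) ^ (β - 1) * 1) s :=
      ((hasDerivAt_id (s : ℂ)).cpow_const (Or.inl (by simpa using hs))).comp_ofReal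
    have h2 : HasDerivAt (fun u : ℝ => Complex.exp (-u)) (Complex.exp (-s) * -1) s :=
      ((hasDerivAt_id (s : ℂ)).neg.cexp).comp_ofReal
    refine ((h1.mul h2).mul (((hy s hs).mul (hz' s hs)).sub ((hy' s hs).mul (hz s hs)))).congr_deriv
      ?_
    have e : (s : ℂ) ^ β = (s : ℂ) ^ (β - 1) * s := by
      rw [← Complex.cpow_add_one_of_ne_zero hs0]; ring_nf
    simp only [Pi.mul_apply, Pi.sub_apply, e]
    linear_combination (s : ℂ) ^ (β - 1) * Complex.exp (-s) *
      (y s * hzode s hs - z s * hyode s hs)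
  have hconst : ∀ s : ℝ, 0 < s → w s = w t := by
    intro s hs
    exact isOpen_Ioi.is_const_of_deriv_eq_zero isPreconnected_Ioi
      (fun u hu => (hd u hu).differentiableAt.differentiableWithinAt)
      (fun u hu => (hd u hu).deriv) hs ht
  have h2 : Tendsto w (𝓝[>] 0) (𝓝 (w t)) :=
    tendsto_const_nhds.congr' (by
      filter_upwards [self_mem_nhdsWithin] with s hs
      exact (hconst s hs).symm)
  exact tendsto_nhds_unique h2 hL

theorem hasDerivAt_cpow_mul_kummerReg (a c : ℂ) {t : ℝ} (ht : 0 < t) :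
    HasDerivAt (fun t : ℝ => (t : ℂ) ^ (c - 1) * kummerReg a c t)
      ((t : ℂ) ^ (c - 2) * kummerReg a (c - 1) t) t := by
  have ht0 : (t : ℂ) ≠ 0 := by exact_mod_cast ht.ne'
  have h1 : HasDerivAt (fun u : ℝ => (u : ℂ) ^ (c - 1)) ((c - 1) * (t : ℂ) ^ (c - 1 - 1) * 1) t :=
    ((hasDerivAt_id (t : ℂ)).cpow_const (Or.inl (by simpa using ht))).comp_ofReal
  refine (h1.mul (hasDerivAt_kummerReg a c t).comp_ofReal).congr_deriv ?_
  have e : (t : ℂ) ^ (c - 1) = (t : ℂ) ^ (c - 2) * t := by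
    rw [← Complex.cpow_add_one_of_ne_zero ht0]; ring_nf
  rw [show c - 1 - 1 = c - 2 by ring, e]
  linear_combination (t : ℂ) ^ (c - 2) * kummerReg_lower a c t

/-- At `t = 0` the integral is a beta integral, convergent because `Re β < 1`; its integrand
dominates as `|e^(-tu)| ≤ 1`. -/
theorem tendsto_tricomiIntegral_zero {α β : ℂ} (hα : 0 < α.re) (hβ : β.re < 1) :
    Tendsto (tricomiIntegral α (β - α - 1)) (𝓝[>] 0)
      (𝓝 (Complex.Gamma α * Complex.Gamma (1 - β) / Complex.Gamma (α - β + 1))) := by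
  have hb : 0 < (1 - β).re := by simp; linarith
  obtain ⟨hi, hv⟩ := integrableOn_and_integral_cpow_mul_one_add_cpow hα hb
  rw [show α - β + 1 = α + (1 - β) by ring, ← hv]
  refine tendsto_integral_filter_of_dominated_convergence _ ?_ ?_ hi.norm ?_
  · exact Eventually.of_forall fun t => (measurable_tricomiIntegrand _ _ t).aestronglyMeasurable
  · filter_upwards [self_mem_nhdsWithin] with t ht
    have ht' : 0 < t := ht
    filter_upwards [ae_restrict_mem measurableSet_Ioi] with u hu
    have hu' : 0 < u := hu
    rw [tricomiIntegrand, norm_mul, show β - α - 1 = -(α + (1 - β)) by ring]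
    apply mul_le_of_le_one_right (norm_nonneg _)
    rw [Complex.norm_exp, Real.exp_le_one_iff]
    simp
    positivity
  · filter_upwards with u
    have : Tendsto (fun t : ℝ => tricomiIntegrand α (β - α - 1) t u) (𝓝 0)
        (𝓝 (tricomiIntegrand α (β - α - 1) 0 u)) := by
      apply Continuous.tendsto
      unfold tricomiIntegrand
      fun_prop
    simp only [tricomiIntegrand, Complex.ofReal_zero, zero_mul, neg_zero, Complex.exp_zero,
      mul_one] at this
    rw [show -(α + (1 - β)) = β - α - 1 by ring]
    exact this.mono_left nhdsWithin_le_nhds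

/-- Substituting `v = tu` yields `∫ v^(α-1) (t+v)^γ e^(-v) dv`, dominated by its value at `t = 0`
because `Re γ ≤ 0`. This gives the singular behaviour of the derivative of Tricomi's integral. -/
theorem tendsto_cpow_mul_tricomiIntegral_zero {α γ : ℂ} (hγ : γ.re ≤ 0)
    (hαγ : 0 < (α + γ).re) :
    Tendsto (fun t : ℝ => (t : ℂ) ^ (α + γ) * tricomiIntegral α γ t) (𝓝[>] 0)
      (𝓝 (Complex.Gamma (α + γ))) := by
  have hgam : ∫ v in Set.Ioi (0 : ℝ), (v : ℂ) ^ (α + γ - 1) * Complex.exp (-((1 : ℝ) * v)) =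
      Complex.Gamma (α + γ) := by
    rw [Complex.integral_cpow_mul_exp_neg_mul_Ioi hαγ one_pos]
    simp
  let g : ℝ → ℝ → ℂ := fun t v =>
    (v : ℂ) ^ (α - 1) * ((t + v : ℝ) : ℂ) ^ γ * Complex.exp (-((1 : ℝ) * v))
  have hsub : ∀ t : ℝ, 0 < t → (t : ℂ) ^ (α + γ) * tricomiIntegral α γ t =
      ∫ v in Set.Ioi (0 : ℝ), g t v := by
    intro t ht
    have ht0 : (t : ℂ) ≠ 0 := by exact_mod_cast ht.ne'
    have h := integral_comp_mul_left_Ioi (g t) 0 ht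
    have e : ∀ u ∈ Set.Ioi (0 : ℝ), g t (t * u) =
        (t : ℂ) ^ (α + γ - 1) * tricomiIntegrand α γ t u := by
      intro u hu
      have hu' : 0 < u := hu
      simp only [g]
      rw [show t + t * u = t * (1 + u) by ring, Complex.ofReal_mul, Complex.ofReal_mul,
        Complex.mul_cpow_ofReal_nonneg ht.le hu'.le,
        Complex.mul_cpow_ofReal_nonneg ht.le (by linarith),
        show α + γ - 1 = α - 1 + γ by ring, Complex.cpow_add _ _ ht0, tricomiIntegrand]
      push_cast
      ring_nf
    rw [setIntegral_congr_fun measurableSet_Ioi e, integral_const_mul, mul_zero,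
      Complex.real_smul] at h
    rw [show α + γ = α + γ - 1 + 1 by ring, Complex.cpow_add_one_of_ne_zero ht0]
    unfold tricomiIntegral
    rw [mul_comm _ (t : ℂ), mul_assoc, h]
    push_cast
    field_simp
  have hlim : Tendsto (fun t => ∫ v in Set.Ioi (0 : ℝ), g t v) (𝓝[>] 0)
      (𝓝 (Complex.Gamma (α + γ))) := by
    rw [← hgam]
    refine tendsto_integral_filter_of_dominated_convergence _ ?_ ?_
      (integrableOn_cpow_mul_exp_neg hαγ one_pos).norm ?_
    · refine Eventually.of_forall fun t => Measurable.aestronglyMeasurable ?_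
      simp only [g]
      fun_prop
    · filter_upwards [self_mem_nhdsWithin] with t ht
      have ht' : 0 < t := ht
      filter_upwards [ae_restrict_mem measurableSet_Ioi] with v hv
      have hv' : 0 < v := hv
      simp only [g, norm_mul, Complex.norm_cpow_eq_rpow_re_of_pos hv',
        Complex.norm_cpow_eq_rpow_re_of_pos (by linarith : 0 < t + v)]
      gcongr
      rw [show (α + γ - 1).re = (α - 1).re + γ.re by simp; ring, Real.rpow_add hv']
      exact mul_le_mul_of_nonneg_left (Real.rpow_le_rpow_of_nonpos hv' (by linarith) hγ)
        (by positivity)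
    · filter_upwards [ae_restrict_mem measurableSet_Ioi] with v hv
      have hv' : 0 < v := hv
      have hv0 : (v : ℂ) ≠ 0 := by exact_mod_cast hv'.ne'
      have h1 : ContinuousAt (fun t : ℝ => g t v) 0 := by
        refine ((continuousAt_const).mul (ContinuousAt.cpow (by fun_prop) continuousAt_const
          (Or.inl ?_))).mul continuousAt_const
        simpa using hv'
      have h2 := h1.tendsto
      rw [show α + γ - 1 = α - 1 + γ by ring, Complex.cpow_add _ _ hv0]
      simp only [g, zero_add] at h2
      exact h2.mono_left nhdsWithin_le_nhds
  refine hlim.congr' ?_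
  filter_upwards [self_mem_nhdsWithin] with t ht
  exact (hsub t ht).symm

theorem tendsto_ofReal_cpow_zero {β : ℂ} (hβ : 0 < β.re) :
    Tendsto (fun t : ℝ => (t : ℂ) ^ β) (𝓝[>] 0) (𝓝 0) := by
  have h := (Complex.continuous_ofReal_cpow_const hβ).tendsto 0
  have hβ0 : β ≠ 0 := by rintro rfl; simp at hβ
  rw [Complex.ofReal_zero, Complex.zero_cpow hβ0] at h
  exact h.mono_left nhdsWithin_le_nhds

theorem tendsto_kummerReg_zero (a c : ℂ) :
    Tendsto (fun t : ℝ => kummerReg a c t) (𝓝[>] 0) (𝓝 (Complex.Gamma c)⁻¹) := by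
  have h := ((continuous_kummerReg a c).comp Complex.continuous_ofReal).tendsto 0
  simp only [Function.comp, Complex.ofReal_zero, kummerReg_zero] at h
  exact h.mono_left nhdsWithin_le_nhds

/-- Three solutions `G, M, N` of a second-order linear equation are dependent, with their Wronskians
as coefficients. In the strip `0 < Re β < 1` all three weighted Wronskians have limits at the
origin. -/
theorem tricomiIntegral_connection_of_re_mem {α β : ℂ} (hα : 0 < α.re) (hβ0 : 0 < β.re)
    (hβ1 : β.re < 1) {t : ℝ} (ht : 0 < t) :
    (Complex.Gamma β)⁻¹ * (Complex.Gamma (1 - β))⁻¹ * tricomiIntegral α (β - α - 1) t =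
      Complex.Gamma α * (Complex.Gamma (α - β + 1))⁻¹ * kummerReg α β t -
        (t : ℂ) ^ (1 - β) * kummerReg (α - β + 1) (2 - β) t := by
  have hα1 : 0 < (α + 1).re := by simp; linarith
  have hGβ : Complex.Gamma β ≠ 0 := Complex.Gamma_ne_zero_of_re_pos hβ0
  have hGβ' : Complex.Gamma (1 - β) ≠ 0 :=
    Complex.Gamma_ne_zero_of_re_pos (by simp; linarith)
  set γ := β - α - 1 with hγ
  set a := α - β + 1 with ha
  -- the three solutions and their derivatives
  have G1 : ∀ s : ℝ, 0 < s → HasDerivAt (tricomiIntegral α γ) (-tricomiIntegral (α + 1) γ s) s :=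
    fun s hs => hasDerivAt_tricomiIntegral hα γ hs
  have G2 : ∀ s : ℝ, 0 < s → HasDerivAt (fun s => -tricomiIntegral (α + 1) γ s)
      (tricomiIntegral (α + 2) γ s) s := by
    intro s hs
    have := (hasDerivAt_tricomiIntegral hα1 γ hs).neg
    rwa [neg_neg, show α + 1 + 1 = α + 2 by ring] at this
  have G3 : ∀ s : ℝ, 0 < s → s * tricomiIntegral (α + 2) γ s +
      (β - s) * (-tricomiIntegral (α + 1) γ s) - α * tricomiIntegral α γ s = 0 := by
    intro s hs
    have := tricomiIntegral_ode hα γ hs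
    rw [show α + γ + 1 = β by rw [hγ]; ring] at this
    linear_combination this
  have M1 : ∀ s : ℝ, 0 < s → HasDerivAt (fun s : ℝ => kummerReg α β s)
      (α * kummerReg (α + 1) (β + 1) s) s :=
    fun s _ => (hasDerivAt_kummerReg α β s).comp_ofReal
  have M2 : ∀ s : ℝ, 0 < s → HasDerivAt (fun s : ℝ => α * kummerReg (α + 1) (β + 1) s)
      (α * ((α + 1) * kummerReg (α + 2) (β + 2) s)) s := by
    intro s _
    have := ((hasDerivAt_kummerReg (α + 1) (β + 1) s).comp_ofReal).const_mul α
    rwa [show α + 1 + 1 = α + 2 by ring, show β + 1 + 1 = β + 2 by ring] at this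
  have M3 : ∀ s : ℝ, 0 < s → s * (α * ((α + 1) * kummerReg (α + 2) (β + 2) s)) +
      (β - s) * (α * kummerReg (α + 1) (β + 1) s) - α * kummerReg α β s = 0 := by
    intro s _
    linear_combination α * kummerReg_ode α β s
  have N1 : ∀ s : ℝ, 0 < s → HasDerivAt (fun s : ℝ => (s : ℂ) ^ (1 - β) * kummerReg a (2 - β) s)
      ((s : ℂ) ^ (-β) * kummerReg a (1 - β) s) s := by
    intro s hs
    have := hasDerivAt_cpow_mul_kummerReg a (2 - β) hs
    rwa [show 2 - β - 1 = 1 - β by ring, show 2 - β - 2 = -β by ring] at this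
  have N2 : ∀ s : ℝ, 0 < s → HasDerivAt (fun s : ℝ => (s : ℂ) ^ (-β) * kummerReg a (1 - β) s)
      ((s : ℂ) ^ (-β - 1) * kummerReg a (-β) s) s := by
    intro s hs
    have := hasDerivAt_cpow_mul_kummerReg a (1 - β) hs
    rwa [show 1 - β - 1 = -β by ring, show 1 - β - 2 = -β - 1 by ring] at this
  have pw : ∀ s : ℝ, 0 < s → (s : ℂ) ^ β * (s : ℂ) ^ (-β) = 1 ∧
      (s : ℂ) ^ (1 - β) = (s : ℂ) ^ (-β) * s ∧ (s : ℂ) ^ (-β) = (s : ℂ) ^ (-β - 1) * s := by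
    intro s hs
    have hs0 : (s : ℂ) ≠ 0 := by exact_mod_cast hs.ne'
    refine ⟨?_, ?_, ?_⟩
    · rw [← Complex.cpow_add _ _ hs0]; simp
    · rw [← Complex.cpow_add_one_of_ne_zero hs0]; ring_nf
    · rw [← Complex.cpow_add_one_of_ne_zero hs0]; ring_nf
  have N3 : ∀ s : ℝ, 0 < s → s * ((s : ℂ) ^ (-β - 1) * kummerReg a (-β) s) +
      (β - s) * ((s : ℂ) ^ (-β) * kummerReg a (1 - β) s) -
      α * ((s : ℂ) ^ (1 - β) * kummerReg a (2 - β) s) = 0 := by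
    intro s hs
    obtain ⟨-, h1, h2⟩ := pw s hs
    have := kummerReg_ode_second a (2 - β) s
    rw [show 2 - β - 2 = -β by ring, show 2 - β - 1 = 1 - β by ring, ha] at this
    rw [h1, h2]
    linear_combination (s : ℂ) ^ (-β - 1) * s * this
  -- limits at the origin
  have E0 : Tendsto (fun s : ℝ => Complex.exp (-s)) (𝓝[>] 0) (𝓝 1) := by
    have : Tendsto (fun s : ℝ => Complex.exp (-s)) (𝓝 0) (𝓝 (Complex.exp (-(0 : ℝ)))) :=
      Continuous.tendsto (by fun_prop) 0
    simp only [Complex.ofReal_zero, neg_zero, Complex.exp_zero] at this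
    exact this.mono_left nhdsWithin_le_nhds
  have T0 : Tendsto (fun s : ℝ => (s : ℂ)) (𝓝[>] 0) (𝓝 0) := by
    simpa using tendsto_ofReal_cpow_zero (β := 1) (by simp)
  have LG : Tendsto (tricomiIntegral α γ) (𝓝[>] 0) (𝓝 (Complex.Gamma α * Complex.Gamma (1 - β) /
      Complex.Gamma a)) := tendsto_tricomiIntegral_zero hα hβ1
  have LG' : Tendsto (fun s : ℝ => (s : ℂ) ^ β * tricomiIntegral (α + 1) γ s) (𝓝[>] 0)
      (𝓝 (Complex.Gamma β)) := by
    have := tendsto_cpow_mul_tricomiIntegral_zero (α := α + 1) (γ := γ)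
      (by simp [hγ]; linarith) (by simp [hγ]; linarith)
    rwa [show α + 1 + γ = β by rw [hγ]; ring] at this
  have LG'' : Tendsto (fun s : ℝ => (s : ℂ) * tricomiIntegral (α + 1) γ s) (𝓝[>] 0) (𝓝 0) := by
    have := (tendsto_ofReal_cpow_zero (β := 1 - β) (by simp; linarith)).mul LG'
    rw [zero_mul] at this
    refine this.congr' ?_
    filter_upwards [self_mem_nhdsWithin] with s hs
    obtain ⟨h1, h2, -⟩ := pw s hs
    rw [h2]
    linear_combination (s : ℂ) * tricomiIntegral (α + 1) γ s * h1
  have W12 := kummer_wronskian_eq (L := (Complex.Gamma β)⁻¹ * (Complex.Gamma (1 - β))⁻¹)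
    M1 M2 N1 N2 M3 N3 (by
      have := E0.mul (((tendsto_kummerReg_zero α β).mul (tendsto_kummerReg_zero a (1 - β))).sub
        (((tendsto_kummerReg_zero (α + 1) (β + 1)).const_mul α).mul
          (T0.mul (tendsto_kummerReg_zero a (2 - β)))))
      simp only [zero_mul, mul_zero, sub_zero, one_mul] at this
      refine this.congr' ?_
      filter_upwards [self_mem_nhdsWithin] with s hs
      obtain ⟨h1, h2, -⟩ := pw s hs
      rw [h2]
      linear_combination -Complex.exp (-s) * (kummerReg α β s * kummerReg a (1 - β) s -
        α * kummerReg (α + 1) (β + 1) s * (s * kummerReg a (2 - β) s)) * h1) ht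
  have WG2 := kummer_wronskian_eq (L := Complex.Gamma α * (Complex.Gamma a)⁻¹)
    G1 G2 N1 N2 G3 N3 (by
      have := E0.mul ((LG.mul (tendsto_kummerReg_zero a (1 - β))).add
        (LG''.mul (tendsto_kummerReg_zero a (2 - β))))
      have e : (1 : ℂ) * (Complex.Gamma α * Complex.Gamma (1 - β) / Complex.Gamma a *
          (Complex.Gamma (1 - β))⁻¹ + 0 * (Complex.Gamma (2 - β))⁻¹) =
          Complex.Gamma α * (Complex.Gamma a)⁻¹ := by
        field_simp
        ring
      rw [e] at this
      refine this.congr' ?_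
      filter_upwards [self_mem_nhdsWithin] with s hs
      obtain ⟨h1, h2, -⟩ := pw s hs
      rw [h2]
      linear_combination -Complex.exp (-s) * (tricomiIntegral α γ s * kummerReg a (1 - β) s +
        tricomiIntegral (α + 1) γ s * (s * kummerReg a (2 - β) s)) * h1) ht
  have WG1 := kummer_wronskian_eq (L := 1) G1 G2 M1 M2 G3 M3 (by
      have := E0.mul ((((tendsto_ofReal_cpow_zero hβ0).mul LG).mul
        ((tendsto_kummerReg_zero (α + 1) (β + 1)).const_mul α)).add
        (LG'.mul (tendsto_kummerReg_zero α β)))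
      rw [zero_mul, zero_mul, zero_add, one_mul, mul_inv_cancel₀ hGβ] at this
      refine this.congr' ?_
      filter_upwards [self_mem_nhdsWithin] with s hs
      ring) ht
  -- What remains is the algebraic identity `G W(M,N) = M W(G,N) - N W(G,M)`, where the weighted
  -- `W(G,M)` is `1`.
  rw [← W12, ← WG2]
  linear_combination (-(t : ℂ) ^ (1 - β) * kummerReg a (2 - β) t) * WG1

/-- The connection formula between Tricomi's integral and the two Frobenius solutions of Kummer's
equation, in a form without exceptional parameters. -/
theorem tricomiIntegral_connection {α : ℂ} (hα : 0 < α.re) (β : ℂ) {t : ℝ} (ht : 0 < t) :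
    (Complex.Gamma β)⁻¹ * (Complex.Gamma (1 - β))⁻¹ * tricomiIntegral α (β - α - 1) t =
      Complex.Gamma α * (Complex.Gamma (α - β + 1))⁻¹ * kummerReg α β t -
        (t : ℂ) ^ (1 - β) * kummerReg (α - β + 1) (2 - β) t := by
  have ht0 : (t : ℂ) ≠ 0 := by exact_mod_cast ht.ne'
  have hG := Complex.differentiable_one_div_Gamma
  have h1 : Differentiable ℂ fun β : ℂ =>
      (Complex.Gamma β)⁻¹ * (Complex.Gamma (1 - β))⁻¹ * tricomiIntegral α (β - α - 1) t :=
    (hG.mul (hG.comp (by fun_prop : Differentiable ℂ fun β : ℂ => 1 - β))).mul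
      ((differentiable_tricomiIntegral hα ht).comp
        (by fun_prop : Differentiable ℂ fun β : ℂ => β - α - 1))
  have h2 : Differentiable ℂ fun β : ℂ =>
      Complex.Gamma α * (Complex.Gamma (α - β + 1))⁻¹ * kummerReg α β t -
        (t : ℂ) ^ (1 - β) * kummerReg (α - β + 1) (2 - β) t :=
    (((hG.comp (by fun_prop : Differentiable ℂ fun β : ℂ => α - β + 1)).const_mul _).mul
      (Differentiable.kummerReg (differentiable_const _) differentiable_id _)).sub
      (((by fun_prop : Differentiable ℂ fun β : ℂ => 1 - β).const_cpow (Or.inl ht0)).mul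
        (Differentiable.kummerReg (by fun_prop) (by fun_prop) _))
  -- Both sides are entire in `β` and agree near `1/2`, inside the strip.
  have key := AnalyticOnNhd.eq_of_eventuallyEq (𝕜 := ℂ) (z₀ := (1 / 2 : ℂ))
    (fun z _ => h1.analyticAt z) (fun z _ => h2.analyticAt z) ?_
  · exact congrFun key β
  · have hre : ContinuousAt Complex.re (1 / 2 : ℂ) := Complex.continuous_re.continuousAt
    filter_upwards [hre.eventually_const_lt (by norm_num : (0 : ℝ) < (1 / 2 : ℂ).re),
      hre.eventually_lt_const (by norm_num : (1 / 2 : ℂ).re < 1)] with β hβ0 hβ1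
    exact tricomiIntegral_connection_of_re_mem hα hβ0 hβ1 ht

/-! ### Mellin transform of Tricomi's integral -/

/-- The Mellin transform of `t ↦ e^(-t) ∫₀^∞ u^(α-1) (1+u)^γ e^(-tu) du`: integrability, value, and
an estimate of the integral of the absolute value. -/
theorem mellin_tricomiIntegral {α γ S : ℂ} (hα : 0 < α.re) (hS : 0 < S.re)
    (hb : 0 < (S - α - γ).re) :
    IntegrableOn (fun t : ℝ => (t : ℂ) ^ (S - 1) * Complex.exp (-t) * tricomiIntegral α γ t)
      (Set.Ioi 0) ∧
    ∫ t in Set.Ioi (0 : ℝ), (t : ℂ) ^ (S - 1) * Complex.exp (-t) * tricomiIntegral α γ t =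
      Complex.Gamma S * (Complex.Gamma α * Complex.Gamma (S - α - γ) / Complex.Gamma (S - γ)) ∧
    ∫ t in Set.Ioi (0 : ℝ), ‖(t : ℂ) ^ (S - 1) * Complex.exp (-t) * tricomiIntegral α γ t‖ ≤
      Real.Gamma S.re * ∫ u in Set.Ioi (0 : ℝ), u ^ (α.re - 1) * (1 + u) ^ (γ.re - S.re) := by
  obtain ⟨hi, hv⟩ := integrableOn_and_integral_cpow_mul_one_add_cpow hα hb
  have e0 : α + (S - α - γ) = S - γ := by ring
  rw [e0] at hi hv
  have e0' : ∀ u ∈ Set.Ioi (0 : ℝ), ‖(u : ℂ) ^ (α - 1) * (1 + u : ℂ) ^ (-(S - γ))‖ =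
      u ^ (α.re - 1) * (1 + u) ^ (γ.re - S.re) := by
    intro u hu
    rw [norm_mul, norm_one_add_ofReal_cpow hu, Complex.norm_cpow_eq_rpow_re_of_pos hu]
    simp
  have hi' : IntegrableOn (fun u : ℝ => u ^ (α.re - 1) * (1 + u) ^ (γ.re - S.re)) (Set.Ioi 0) :=
    IntegrableOn.congr_fun hi.norm e0' measurableSet_Ioi
  -- Integrating in `t` first leaves `Γ(S) u^(α-1) (1+u)^(γ-S)`, a beta integrand. The same
  -- computation with absolute values gives both integrability and the norm bound.
  let F : ℝ → ℝ → ℂ := fun t u => (t : ℂ) ^ (S - 1) * Complex.exp (-t) * tricomiIntegrand α γ t u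
  have hF : ∀ t u : ℝ, F t u = (u : ℂ) ^ (α - 1) * (1 + u : ℂ) ^ γ *
      ((t : ℂ) ^ (S - 1) * Complex.exp (-((1 + u : ℝ) * t))) := by
    intro t u
    have : Complex.exp (-((1 + u : ℝ) * t)) = Complex.exp (-t) * Complex.exp (-(t * u)) := by
      rw [← Complex.exp_add]; push_cast; ring_nf
    simp only [F, tricomiIntegrand, this]
    ring
  have hmeas : AEStronglyMeasurable (Function.uncurry F)
      ((volume.restrict (Set.Ioi 0)).prod (volume.restrict (Set.Ioi 0))) := by
    apply Measurable.aestronglyMeasurable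
    unfold F Function.uncurry tricomiIntegrand
    fun_prop
  have hnorm : ∀ u ∈ Set.Ioi (0 : ℝ), ∫ t in Set.Ioi (0 : ℝ), ‖F t u‖ =
      Real.Gamma S.re * (u ^ (α.re - 1) * (1 + u) ^ (γ.re - S.re)) := by
    intro u hu
    have hu' : 0 < u := hu
    have h1u : 0 < 1 + u := by linarith
    have e : ∀ t ∈ Set.Ioi (0 : ℝ), ‖F t u‖ = u ^ (α.re - 1) * (1 + u) ^ γ.re *
        (t ^ (S.re - 1) * Real.exp (-((1 + u) * t))) := by
      intro t ht
      rw [hF, norm_mul, norm_mul, norm_mul, norm_one_add_ofReal_cpow hu,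
        Complex.norm_cpow_eq_rpow_re_of_pos hu, Complex.norm_cpow_eq_rpow_re_of_pos ht,
        Complex.norm_exp]
      simp
    rw [setIntegral_congr_fun measurableSet_Ioi e, integral_const_mul,
      Real.integral_rpow_mul_exp_neg_mul_Ioi hS h1u, one_div, Real.inv_rpow h1u.le,
      Real.rpow_sub h1u]
    ring
  have hint : Integrable (Function.uncurry F)
      ((volume.restrict (Set.Ioi 0)).prod (volume.restrict (Set.Ioi 0))) := by
    rw [integrable_prod_iff' hmeas]
    constructor
    · filter_upwards [ae_restrict_mem measurableSet_Ioi] with u hu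
      have h1u : 0 < 1 + u := by have : 0 < u := hu; linarith
      simp only [Function.uncurry, hF]
      exact (integrableOn_cpow_mul_exp_neg hS h1u).const_mul _
    · exact IntegrableOn.congr_fun (hi'.const_mul (Real.Gamma S.re))
        (fun u hu => (hnorm u hu).symm) measurableSet_Ioi
  have ht : ∀ t : ℝ, ∫ u in Set.Ioi (0 : ℝ), F t u =
      (t : ℂ) ^ (S - 1) * Complex.exp (-t) * tricomiIntegral α γ t := by
    intro t
    simp only [F, tricomiIntegral]
    rw [integral_const_mul]
  have hu : ∀ u ∈ Set.Ioi (0 : ℝ), ∫ t in Set.Ioi (0 : ℝ), F t u =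
      Complex.Gamma S * ((u : ℂ) ^ (α - 1) * (1 + u : ℂ) ^ (-(S - γ))) := by
    intro u hu
    have h1u : 0 < 1 + u := by have : 0 < u := hu; linarith
    simp only [hF]
    rw [integral_const_mul, Complex.integral_cpow_mul_exp_neg_mul_Ioi hS h1u,
      one_div_ofReal_cpow h1u, show -(S - γ) = γ + -S by ring,
      Complex.cpow_add _ _ (one_add_ofReal_ne_zero hu)]
    push_cast
    ring
  refine ⟨?_, ?_, ?_⟩
  · refine IntegrableOn.congr_fun hint.integral_prod_left (fun t _ => ?_) measurableSet_Ioi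
    exact ht t
  · have h := integral_integral_swap hint
    rw [setIntegral_congr_fun measurableSet_Ioi hu, integral_const_mul, hv] at h
    simpa only [ht] using h
  · calc _ = ∫ t in Set.Ioi (0 : ℝ), ‖∫ u in Set.Ioi (0 : ℝ), F t u‖ := by simp only [ht]
      _ ≤ ∫ t in Set.Ioi (0 : ℝ), ∫ u in Set.Ioi (0 : ℝ), ‖F t u‖ :=
        integral_mono hint.integral_prod_left.norm hint.norm.integral_prod_left
          fun t => norm_integral_le_integral_norm _
      _ = ∫ u in Set.Ioi (0 : ℝ), ∫ t in Set.Ioi (0 : ℝ), ‖F t u‖ :=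
        integral_integral_swap hint.norm
      _ = _ := by
        rw [setIntegral_congr_fun measurableSet_Ioi hnorm, integral_const_mul]

/-! ### Whittaker functions through Kummer and Tricomi -/

/-- `whittakerConnection` in terms of the regularized Kummer function. -/
theorem whittakerConnection_eq_kummerReg (τ : ℂ) {s : ℂ} (hs : ∀ n : ℤ, 2 * s ≠ n) (z : ℂ) :
    whittakerConnection τ s z = Complex.Gamma (-2 * s) * Complex.Gamma (2 * s + 1) *
      Complex.exp (-z / 2) *
      (z ^ (1 / 2 + s) *
          ((Complex.Gamma (1 / 2 - τ - s))⁻¹ * kummerReg (1 / 2 + s - τ) (2 * s + 1) z) -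
        z ^ (1 / 2 - s) *
          ((Complex.Gamma (1 / 2 - τ + s))⁻¹ * kummerReg (1 / 2 - s - τ) (1 - 2 * s) z)) := by
  have h2s : 2 * s ≠ 0 := by simpa using hs 0
  have h1 : ∀ k : ℕ, 2 * s + 1 ≠ -k := fun k h => hs (-k - 1) (by push_cast; linear_combination h)
  have h2 : ∀ k : ℕ, 2 * -s + 1 ≠ -k := fun k h => hs (k + 1) (by push_cast; linear_combination -h)
  -- These give `Γ(2s) Γ(1-2s) = -Γ(-2s) Γ(2s+1)`, the source of the minus sign between the two
  -- halves.
  have g1 := Complex.Gamma_add_one (2 * s) h2s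
  have g2 := Complex.Gamma_add_one (-2 * s) (by simpa using h2s)
  rw [whittakerConnection, whittakerM, whittakerM, kummerF_eq_Gamma_mul_kummerReg _ h1,
    kummerF_eq_Gamma_mul_kummerReg _ h2, show 2 * -s + 1 = -2 * s + 1 by ring, g1, g2,
    show 1 / 2 + -s = 1 / 2 - s by ring, show -2 * s + 1 = 1 - 2 * s by ring]
  ring

/-- The step `τ ± 1` is `a ∓ 1` in the contiguous relation, and the reciprocal Gamma factor makes
the coefficients even in `s`. Hence the half with `-s` obeys the same recurrence. -/
theorem whittakerConnection_half_recurrence (τ s z : ℂ) :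
    (Complex.Gamma (1 / 2 - (τ + 1) - s))⁻¹ * kummerReg (1 / 2 + s - (τ + 1)) (2 * s + 1) z =
      (z - 2 * τ) * ((Complex.Gamma (1 / 2 - τ - s))⁻¹ * kummerReg (1 / 2 + s - τ) (2 * s + 1) z) -
      ((τ - 1 / 2) ^ 2 - s ^ 2) * ((Complex.Gamma (1 / 2 - (τ - 1) - s))⁻¹ *
        kummerReg (1 / 2 + s - (τ - 1)) (2 * s + 1) z) := by
  have h := kummerReg_contiguous (1 / 2 + s - τ) (2 * s + 1) z
  have g1 := Complex.one_div_Gamma_eq_self_mul_one_div_Gamma_add_one (1 / 2 - τ - s)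
  have g2 := Complex.one_div_Gamma_eq_self_mul_one_div_Gamma_add_one (1 / 2 - (τ + 1) - s)
  rw [show 1 / 2 - (τ + 1) - s + 1 = 1 / 2 - τ - s by ring] at g2
  rw [g2, g1, show 1 / 2 - (τ - 1) - s = 1 / 2 - τ - s + 1 by ring,
    show 1 / 2 + s - (τ + 1) = 1 / 2 + s - τ - 1 by ring,
    show 1 / 2 + s - (τ - 1) = 1 / 2 + s - τ + 1 by ring]
  linear_combination -(1 / 2 - τ - s) * (Complex.Gamma (1 / 2 - τ - s + 1))⁻¹ * h

theorem whittakerConnection_recurrence (τ : ℂ) {s : ℂ} (hs : ∀ n : ℤ, 2 * s ≠ n) (z : ℂ) :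
    whittakerConnection (τ + 1) s z = (z - 2 * τ) * whittakerConnection τ s z -
      ((τ - 1 / 2) ^ 2 - s ^ 2) * whittakerConnection (τ - 1) s z := by
  have h1 := whittakerConnection_half_recurrence τ s z
  have h2 := whittakerConnection_half_recurrence τ (-s) z
  simp only [sub_neg_eq_add, ← sub_eq_add_neg, show 2 * -s + 1 = 1 - 2 * s by ring, neg_sq] at h2
  simp only [whittakerConnection_eq_kummerReg _ hs, h1, h2]
  ring

/-- This is the connection formula at `α = 1/2+s-τ`, `β = 2s+1`. Since `2s` is not an integer, the
Gamma factors in front of Tricomi's integral can be divided out. -/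
theorem whittakerConnection_eq_tricomiIntegral {τ s : ℂ} (hs : ∀ n : ℤ, 2 * s ≠ n)
    (hα : 0 < (1 / 2 + s - τ).re) {t : ℝ} (ht : 0 < t) :
    whittakerConnection τ s t = Complex.exp (-t / 2) * (t : ℂ) ^ (1 / 2 + s) *
      ((Complex.Gamma (1 / 2 + s - τ))⁻¹ *
        tricomiIntegral (1 / 2 + s - τ) (s + τ - 1 / 2) t) := by
  have ht0 : (t : ℂ) ≠ 0 := by exact_mod_cast ht.ne'
  have hG : Complex.Gamma (1 / 2 + s - τ) ≠ 0 := Complex.Gamma_ne_zero_of_re_pos hα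
  have hG1 : Complex.Gamma (2 * s + 1) ≠ 0 := Complex.Gamma_ne_zero fun k h =>
    hs (-k - 1) (by push_cast; linear_combination h)
  have hG2 : Complex.Gamma (-2 * s) ≠ 0 := Complex.Gamma_ne_zero fun k h =>
    hs k (by push_cast; linear_combination -h)
  have h := tricomiIntegral_connection hα (2 * s + 1) ht
  rw [show 2 * s + 1 - (1 / 2 + s - τ) - 1 = s + τ - 1 / 2 by ring,
    show 1 / 2 + s - τ - (2 * s + 1) + 1 = 1 / 2 - τ - s by ring,
    show 1 - (2 * s + 1) = -2 * s by ring, show 2 - (2 * s + 1) = 1 - 2 * s by ring] at h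
  have h' : tricomiIntegral (1 / 2 + s - τ) (s + τ - 1 / 2) t =
      Complex.Gamma (2 * s + 1) * Complex.Gamma (-2 * s) * (Complex.Gamma (1 / 2 + s - τ) *
      (Complex.Gamma (1 / 2 - τ - s))⁻¹ * kummerReg (1 / 2 + s - τ) (2 * s + 1) t -
      (t : ℂ) ^ (-2 * s) * kummerReg (1 / 2 - τ - s) (1 - 2 * s) t) := by
    rw [← h]
    generalize Complex.Gamma (2 * s + 1) = A at hG1
    generalize Complex.Gamma (-2 * s) = B at hG2
    generalize tricomiIntegral (1 / 2 + s - τ) (s + τ - 1 / 2) t = T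
    field_simp
  have hp : (t : ℂ) ^ (1 / 2 - s) = (t : ℂ) ^ (1 / 2 + s) * (t : ℂ) ^ (-2 * s) := by
    rw [← Complex.cpow_add _ _ ht0]; ring_nf
  rw [whittakerConnection_eq_kummerReg _ hs, h', hp,
    show 1 / 2 - s - τ = 1 / 2 - τ - s by ring, show 1 / 2 - τ + s = 1 / 2 + s - τ by ring]
  linear_combination -Complex.Gamma (-2 * s) * Complex.Gamma (2 * s + 1) *
    Complex.exp (-t / 2) * (t : ℂ) ^ (1 / 2 + s) * ((Complex.Gamma (1 / 2 - τ - s))⁻¹ *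
    kummerReg (1 / 2 + s - τ) (2 * s + 1) t) * mul_inv_cancel₀ hG

/-! ### Mellin transform and moments of the Whittaker function for all `τ`, `ω` -/

/-- `f` is the Whittaker function `W_{τ,ω}` on the half line, together with its Mellin transform
and an estimate of the absolute moments. -/
structure IsWhittakerOnHalfLine (τ ω : ℂ) (f : ℝ → ℂ) : Prop where
  tendsto : ∀ t : ℝ, 0 < t →
    Tendsto (fun s : ℂ => whittakerConnection τ s t) (𝓝[≠] ω) (𝓝 (f t))
  eq_connection : (∀ n : ℤ, 2 * ω ≠ n) → ∀ t : ℝ, 0 < t → f t = whittakerConnection τ ω t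
  integrableOn : ∀ s : ℂ, -(1 / 2) < (s + ω).re → -(1 / 2) < (s - ω).re →
    IntegrableOn (fun t : ℝ => (t : ℂ) ^ (s - 1) * Complex.exp (-t / 2) * f t) (Set.Ioi 0)
  integral_eq : ∀ s : ℂ, -(1 / 2) < (s + ω).re → -(1 / 2) < (s - ω).re →
    ∫ t in Set.Ioi (0 : ℝ), (t : ℂ) ^ (s - 1) * Complex.exp (-t / 2) * f t =
      Complex.Gamma (1 / 2 + ω + s) * Complex.Gamma (1 / 2 - ω + s) / Complex.Gamma (1 - τ + s)
  integral_norm_le : ∃ C N σ₀ : ℝ, 0 ≤ C ∧ ∀ s : ℂ, σ₀ ≤ s.re →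
    ∫ t in Set.Ioi (0 : ℝ), ‖(t : ℂ) ^ (s - 1) * Complex.exp (-t / 2) * f t‖ ≤
      C * Real.Gamma (s.re + N)

theorem IsWhittakerOnHalfLine.whittakerW_eq {τ ω : ℂ} {f : ℝ → ℂ}
    (h : IsWhittakerOnHalfLine τ ω f) {t : ℝ} (ht : 0 < t) : whittakerW τ ω t = f t := by
  unfold whittakerW
  split_ifs with hω
  · exact (h.tendsto t ht).limUnder_eq
  · push Not at hω
    exact (h.eq_connection hω t ht).symm

/-- Integers are isolated and form a closed set. Thus the limit defining `W` at integer `2ω` only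
sees indices where the generic formulas hold. -/
theorem eventually_two_mul_ne_int (ω : ℂ) : ∀ᶠ s : ℂ in 𝓝[≠] ω, ∀ n : ℤ, 2 * s ≠ n := by
  have hinj : Function.Injective fun s : ℂ => 2 * s := mul_right_injective₀ two_ne_zero
  by_cases hω : ∃ n : ℤ, 2 * ω = n
  · obtain ⟨m, hm⟩ := hω
    have : ∀ᶠ s : ℂ in 𝓝 ω, ‖2 * s - 2 * ω‖ < 1 := by
      have hc : ContinuousAt (fun s : ℂ => ‖2 * s - 2 * ω‖) ω := by fun_prop
      exact hc.eventually_lt_const (by simp)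
    filter_upwards [this.filter_mono nhdsWithin_le_nhds, self_mem_nhdsWithin] with s hs hne n hn
    rw [hn, hm] at hs
    have h1 : |((n - m : ℤ) : ℝ)| < 1 := by
      rw [← Complex.norm_intCast]; push_cast; exact hs
    have h2 : |n - m| < 1 := by exact_mod_cast h1
    rw [Int.abs_lt_one_iff, sub_eq_zero] at h2
    exact hne (hinj (by simp only [hn, hm, h2]))
  · have hclosed : IsClosed (Set.range ((↑) : ℤ → ℂ)) := Complex.isClosedEmbedding_intCast.isClosed_range
    have hop : IsOpen ((fun s : ℂ => 2 * s) ⁻¹' (Set.range ((↑) : ℤ → ℂ))ᶜ) :=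
      hclosed.isOpen_compl.preimage (by fun_prop)
    have := hop.mem_nhds (x := ω) (by rintro ⟨n, hn⟩; exact hω ⟨n, hn.symm⟩)
    filter_upwards [mem_nhdsWithin_of_mem_nhds this] with s hs n hn
    exact hs ⟨n, hn.symm⟩

theorem continuousAt_whittaker_tricomiIntegral {τ ω : ℂ} (hα : 0 < (1 / 2 + ω - τ).re) {t : ℝ}
    (ht : 0 < t) :
    ContinuousAt (fun s : ℂ => Complex.exp (-t / 2) * (t : ℂ) ^ (1 / 2 + s) *
      ((Complex.Gamma (1 / 2 + s - τ))⁻¹ *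
        tricomiIntegral (1 / 2 + s - τ) (s + τ - 1 / 2) t)) ω := by
  have ht0 : (t : ℂ) ≠ 0 := by exact_mod_cast ht.ne'
  have h1 : ContinuousAt (fun s : ℂ => (t : ℂ) ^ (1 / 2 + s)) ω :=
    ContinuousAt.const_cpow (by fun_prop) (Or.inl ht0)
  have h2 : Continuous fun s : ℂ => (Complex.Gamma (1 / 2 + s - τ))⁻¹ :=
    Complex.differentiable_one_div_Gamma.continuous.comp
      (by fun_prop : Continuous fun s : ℂ => 1 / 2 + s - τ)
  have h3 : ContinuousAt (fun s : ℂ => tricomiIntegral (1 / 2 + s - τ) (s + τ - 1 / 2) t) ω :=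
    continuousAt_tricomiIntegral (f := fun s => 1 / 2 + s - τ) (g := fun s => s + τ - 1 / 2)
      (by fun_prop) (by fun_prop) hα ht
  exact (h1.const_mul _).mul (h2.continuousAt.mul h3)

/-- The base case: Tricomi's representation is continuous in the index, also at integer `2ω`, and
its Mellin transform is known with `S = 1/2+ω+s`. -/
theorem isWhittakerOnHalfLine_of_re_pos {τ ω : ℂ} (hα : 0 < (1 / 2 + ω - τ).re) :
    IsWhittakerOnHalfLine τ ω fun t => Complex.exp (-t / 2) * (t : ℂ) ^ (1 / 2 + ω) *
      ((Complex.Gamma (1 / 2 + ω - τ))⁻¹ *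
        tricomiIntegral (1 / 2 + ω - τ) (ω + τ - 1 / 2) t) := by
  have hG : Complex.Gamma (1 / 2 + ω - τ) ≠ 0 := Complex.Gamma_ne_zero_of_re_pos hα
  have hint : ∀ s : ℂ, ∀ t ∈ Set.Ioi (0 : ℝ), (t : ℂ) ^ (s - 1) * Complex.exp (-t / 2) *
      (Complex.exp (-t / 2) * (t : ℂ) ^ (1 / 2 + ω) * ((Complex.Gamma (1 / 2 + ω - τ))⁻¹ *
        tricomiIntegral (1 / 2 + ω - τ) (ω + τ - 1 / 2) t)) =
      (Complex.Gamma (1 / 2 + ω - τ))⁻¹ * ((t : ℂ) ^ (1 / 2 + ω + s - 1) * Complex.exp (-t) *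
        tricomiIntegral (1 / 2 + ω - τ) (ω + τ - 1 / 2) t) := by
    intro s t ht
    have ht0 : (t : ℂ) ≠ 0 := by exact_mod_cast (ne_of_gt ht)
    have he : Complex.exp (-t) = Complex.exp (-t / 2) * Complex.exp (-t / 2) := by
      rw [← Complex.exp_add]; ring_nf
    rw [show 1 / 2 + ω + s - 1 = s - 1 + (1 / 2 + ω) by ring,
      Complex.cpow_add (s - 1) (1 / 2 + ω) ht0, he]
    ring
  have key : ∀ s : ℂ, -(1 / 2) < (s + ω).re → -(1 / 2) < (s - ω).re → _ := fun s h1 h2 =>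
    mellin_tricomiIntegral (α := 1 / 2 + ω - τ) (γ := ω + τ - 1 / 2) (S := 1 / 2 + ω + s) hα
    (by simp at h1 ⊢; linarith) (by simp at h2 ⊢; linarith)
  refine ⟨?_, ?_, ?_, ?_, ?_⟩
  · intro t ht
    have ht0 : (t : ℂ) ≠ 0 := by exact_mod_cast ht.ne'
    have hc := continuousAt_whittaker_tricomiIntegral hα ht
    refine (hc.tendsto.mono_left nhdsWithin_le_nhds).congr' ?_
    have hre : ContinuousAt (fun s : ℂ => (1 / 2 + s - τ).re) ω := by fun_prop
    filter_upwards [eventually_two_mul_ne_int ω,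
      (hre.eventually_const_lt hα).filter_mono nhdsWithin_le_nhds] with s h1 h2
    exact (whittakerConnection_eq_tricomiIntegral h1 h2 ht).symm
  · intro hω t ht
    exact (whittakerConnection_eq_tricomiIntegral hω hα ht).symm
  · intro s h1 h2
    exact IntegrableOn.congr_fun ((key s h1 h2).1.const_mul _)
      (fun t ht => (hint s t ht).symm) measurableSet_Ioi
  · intro s h1 h2
    rw [setIntegral_congr_fun measurableSet_Ioi (hint s), integral_const_mul, (key s h1 h2).2.1,
      show 1 / 2 + ω + s - (1 / 2 + ω - τ) - (ω + τ - 1 / 2) = 1 / 2 - ω + s by ring,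
      show 1 / 2 + ω + s - (ω + τ - 1 / 2) = 1 - τ + s by ring]
    generalize Complex.Gamma (1 / 2 + ω - τ) = A at hG
    field_simp
  -- For `Re s ≥ |Re ω|` both convergence conditions hold, and the remaining `u`-integral decreases
  -- in `Re s`, so its value at `σ₀` is a uniform constant.
  · set σ₀ : ℝ := |ω.re| with hσ
    set A := (1 / 2 + ω - τ).re
    set g := (ω + τ - 1 / 2).re
    refine ⟨‖(Complex.Gamma (1 / 2 + ω - τ))⁻¹‖ *
      ∫ u in Set.Ioi (0 : ℝ), u ^ (A - 1) * (1 + u) ^ (g - (1 / 2 + ω.re + σ₀)), 1 / 2 + ω.re, σ₀,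
      ?_, ?_⟩
    · refine mul_nonneg (norm_nonneg _) (setIntegral_nonneg measurableSet_Ioi fun u hu => ?_)
      have hu' : 0 < u := hu
      positivity
    · intro s hs
      have a1 := abs_le.1 (le_of_eq hσ.symm)
      have h1 : -(1 / 2) < (s + ω).re := by rw [Complex.add_re]; linarith
      have h2 : -(1 / 2) < (s - ω).re := by rw [Complex.sub_re]; linarith
      have hS : (1 / 2 + ω + s).re = 1 / 2 + ω.re + s.re := by simp
      have hSpos : 0 < (1 / 2 + ω + s).re := by rw [hS]; linarith
      rw [setIntegral_congr_fun measurableSet_Ioi fun t ht => congrArg norm (hint s t ht)]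
      simp only [norm_mul (Complex.Gamma (1 / 2 + ω - τ))⁻¹]
      rw [integral_const_mul]
      have hk := (key s h1 h2).2.2
      have i1 : ∀ x : ℝ, σ₀ ≤ x → IntegrableOn
          (fun u : ℝ => u ^ (A - 1) * (1 + u) ^ (g - (1 / 2 + ω.re + x))) (Set.Ioi 0) := by
        intro x hx
        have hb : 0 < (1 / 2 - ω + x : ℂ).re := by simp; linarith
        refine IntegrableOn.congr_fun
          (integrableOn_and_integral_cpow_mul_one_add_cpow hα hb).1.norm
          (fun u hu => ?_) measurableSet_Ioi
        rw [norm_mul, norm_one_add_ofReal_cpow hu, Complex.norm_cpow_eq_rpow_re_of_pos hu]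
        congr 2
        simp [g]
        ring
      have hJ : ∫ u in Set.Ioi (0 : ℝ), u ^ (A - 1) * (1 + u) ^ (g - (1 / 2 + ω.re + s.re)) ≤
          ∫ u in Set.Ioi (0 : ℝ), u ^ (A - 1) * (1 + u) ^ (g - (1 / 2 + ω.re + σ₀)) := by
        refine setIntegral_mono_on (i1 _ hs) (i1 _ le_rfl) measurableSet_Ioi fun u hu => ?_
        have hu' : 0 < u := hu
        gcongr
        · linarith
      have hGpos : 0 < Real.Gamma (1 / 2 + ω + s).re := Real.Gamma_pos_of_pos hSpos
      rw [hS] at hk hGpos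
      calc _ ≤ ‖(Complex.Gamma (1 / 2 + ω - τ))⁻¹‖ * (Real.Gamma (1 / 2 + ω.re + s.re) *
            ∫ u in Set.Ioi (0 : ℝ), u ^ (A - 1) * (1 + u) ^ (g - (1 / 2 + ω.re + σ₀))) := by
            gcongr
            exact hk.trans (by gcongr)
        _ = _ := by rw [add_comm s.re]; ring

/-- The Mellin image of the recurrence in `τ`, where multiplication by `t` shifts `s` to `s+1`. The
functional equation reduces it to a polynomial identity. -/
theorem gammaQuotient_recurrence (τ ω s : ℂ) (h1 : -(1 / 2) < (s + ω).re)
    (h2 : -(1 / 2) < (s - ω).re) :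
    Complex.Gamma (1 / 2 + ω + (s + 1)) * Complex.Gamma (1 / 2 - ω + (s + 1)) /
        Complex.Gamma (1 - τ + (s + 1)) -
      2 * τ * (Complex.Gamma (1 / 2 + ω + s) * Complex.Gamma (1 / 2 - ω + s) /
        Complex.Gamma (1 - τ + s)) -
      ((τ - 1 / 2) ^ 2 - ω ^ 2) * (Complex.Gamma (1 / 2 + ω + s) * Complex.Gamma (1 / 2 - ω + s) /
        Complex.Gamma (1 - (τ - 1) + s)) =
    Complex.Gamma (1 / 2 + ω + s) * Complex.Gamma (1 / 2 - ω + s) /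
      Complex.Gamma (1 - (τ + 1) + s) := by
  have n1 : 1 / 2 + ω + s ≠ 0 := by
    intro h
    have := congrArg Complex.re h
    simp at this h1
    linarith
  have n2 : 1 / 2 - ω + s ≠ 0 := by
    intro h
    have := congrArg Complex.re h
    simp at this h2
    linarith
  have g1 := Complex.Gamma_add_one _ n1
  have g2 := Complex.Gamma_add_one _ n2
  have g3 := Complex.one_div_Gamma_eq_self_mul_one_div_Gamma_add_one (1 - τ + s)
  have g4 := Complex.one_div_Gamma_eq_self_mul_one_div_Gamma_add_one (1 - (τ + 1) + s)
  rw [show 1 - (τ + 1) + s + 1 = 1 - τ + s by ring, g3] at g4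
  rw [← add_assoc, g1, ← add_assoc, g2, ← add_assoc,
    show 1 - (τ - 1) + s = 1 - τ + s + 1 by ring, div_eq_mul_inv _ (Complex.Gamma (1 - τ + s)),
    div_eq_mul_inv _ (Complex.Gamma (1 - (τ + 1) + s)), g4, g3]
  ring

theorem IsWhittakerOnHalfLine.step {τ ω : ℂ} {f g : ℝ → ℂ} (hf : IsWhittakerOnHalfLine τ ω f)
    (hg : IsWhittakerOnHalfLine (τ - 1) ω g) :
    IsWhittakerOnHalfLine (τ + 1) ω fun t =>
      (t - 2 * τ) * f t - ((τ - 1 / 2) ^ 2 - ω ^ 2) * g t := by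
  have e : ∀ s : ℂ, ∀ t ∈ Set.Ioi (0 : ℝ), (t : ℂ) ^ (s - 1) * Complex.exp (-t / 2) *
      ((t - 2 * τ) * f t - ((τ - 1 / 2) ^ 2 - ω ^ 2) * g t) =
      (t : ℂ) ^ (s + 1 - 1) * Complex.exp (-t / 2) * f t -
        2 * τ * ((t : ℂ) ^ (s - 1) * Complex.exp (-t / 2) * f t) -
        ((τ - 1 / 2) ^ 2 - ω ^ 2) * ((t : ℂ) ^ (s - 1) * Complex.exp (-t / 2) * g t) := by
    intro s t ht
    have ht0 : (t : ℂ) ≠ 0 := by exact_mod_cast (ne_of_gt ht)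
    rw [show s + 1 - 1 = s - 1 + 1 by ring, Complex.cpow_add_one_of_ne_zero ht0]
    ring
  have hr : ∀ s : ℂ, -(1 / 2) < (s + ω).re → -(1 / 2) < (s - ω).re →
      -(1 / 2) < (s + 1 + ω).re ∧ -(1 / 2) < (s + 1 - ω).re := by
    intro s h1 h2
    simp at h1 h2 ⊢
    constructor <;> linarith
  refine ⟨?_, ?_, ?_, ?_, ?_⟩
  · intro t ht
    have hs : Tendsto (fun s : ℂ => (τ - 1 / 2) ^ 2 - s ^ 2) (𝓝[≠] ω)
        (𝓝 ((τ - 1 / 2) ^ 2 - ω ^ 2)) :=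
      (Continuous.tendsto (by fun_prop) ω).mono_left nhdsWithin_le_nhds
    refine (((hf.tendsto t ht).const_mul ((t : ℂ) - 2 * τ)).sub
      (hs.mul (hg.tendsto t ht))).congr' ?_
    filter_upwards [eventually_two_mul_ne_int ω] with s h
    exact (whittakerConnection_recurrence τ h t).symm
  · intro hω t ht
    rw [whittakerConnection_recurrence τ hω, hf.eq_connection hω t ht, hg.eq_connection hω t ht]
  · intro s h1 h2
    obtain ⟨h3, h4⟩ := hr s h1 h2
    exact IntegrableOn.congr_fun (((hf.integrableOn _ h3 h4).sub
      ((hf.integrableOn s h1 h2).const_mul (2 * τ))).sub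
      ((hg.integrableOn s h1 h2).const_mul ((τ - 1 / 2) ^ 2 - ω ^ 2)))
      (fun t ht => (e s t ht).symm) measurableSet_Ioi
  · intro s h1 h2
    obtain ⟨h3, h4⟩ := hr s h1 h2
    have i1 := hf.integrableOn _ h3 h4
    have i2 := (hf.integrableOn s h1 h2).const_mul (2 * τ)
    have i3 := (hg.integrableOn s h1 h2).const_mul ((τ - 1 / 2) ^ 2 - ω ^ 2)
    rw [setIntegral_congr_fun measurableSet_Ioi (e s)]
    refine (integral_sub (i1.sub i2) i3).trans ?_
    rw [integral_sub' i1 i2, integral_const_mul, integral_const_mul, hf.integral_eq _ h3 h4,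
      hf.integral_eq s h1 h2, hg.integral_eq s h1 h2]
    exact gammaQuotient_recurrence τ ω s h1 h2
  · obtain ⟨C₁, N₁, σ₁, hC₁, b1⟩ := hf.integral_norm_le
    obtain ⟨C₂, N₂, σ₂, hC₂, b2⟩ := hg.integral_norm_le
    set K := ‖(τ - 1 / 2) ^ 2 - ω ^ 2‖
    set N := max (N₁ + 1) N₂ with hN
    -- The factor `t` costs the `+1` in `N`. The thresholds `2 - N₁`, `2 - N₂` keep all Gamma
    -- arguments at least `2`, where `Γ` increases, so that one Gamma value bounds the three.
    refine ⟨C₁ + ‖2 * τ‖ * C₁ + K * C₂, N,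
      max (max σ₁ σ₂) (max |ω.re| (max (2 - N₁) (2 - N₂))), by positivity, ?_⟩
    intro s hs
    simp only [max_le_iff] at hs
    obtain ⟨⟨s1, s2⟩, s3, s4, s5⟩ := hs
    obtain ⟨a1, a2⟩ := abs_le.1 s3
    have h1 : -(1 / 2) < (s + ω).re := by rw [Complex.add_re]; linarith
    have h2 : -(1 / 2) < (s - ω).re := by rw [Complex.sub_re]; linarith
    obtain ⟨h3, h4⟩ := hr s h1 h2
    have i1 := (hf.integrableOn _ h3 h4).norm
    have i2 := (hf.integrableOn s h1 h2).norm.const_mul ‖2 * τ‖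
    have i3 := (hg.integrableOn s h1 h2).norm.const_mul K
    have m : ∀ x : ℝ, 2 ≤ x → x ≤ s.re + N → Real.Gamma x ≤ Real.Gamma (s.re + N) :=
      fun x hx hxN => Real.Gamma_strictMonoOn_Ici.monotoneOn hx (hx.trans hxN) hxN
    have hN1 : N₁ + 1 ≤ N := le_max_left _ _
    have hN2 : N₂ ≤ N := le_max_right _ _
    have m1 := m (s.re + 1 + N₁) (by linarith) (by linarith)
    have m2 := m (s.re + N₁) (by linarith) (by linarith)
    have m3 := m (s.re + N₂) (by linarith) (by linarith)
    have c1 := b1 (s + 1) (by simp; linarith)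
    have c2 := b1 s s1
    have c3 := b2 s s2
    rw [Complex.add_re, Complex.one_re] at c1
    calc _ ≤ ∫ t in Set.Ioi (0 : ℝ),
          (‖(t : ℂ) ^ (s + 1 - 1) * Complex.exp (-t / 2) * f t‖ +
          ‖2 * τ‖ * ‖(t : ℂ) ^ (s - 1) * Complex.exp (-t / 2) * f t‖ +
          K * ‖(t : ℂ) ^ (s - 1) * Complex.exp (-t / 2) * g t‖) := by
          refine integral_mono_of_nonneg (Eventually.of_forall fun t => norm_nonneg _)
            ((i1.add i2).add i3) ?_
          filter_upwards [ae_restrict_mem measurableSet_Ioi] with t ht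
          rw [e s t ht]
          refine (norm_sub_le _ _).trans ?_
          rw [norm_mul ((τ - 1 / 2) ^ 2 - ω ^ 2)]
          gcongr
          refine (norm_sub_le _ _).trans ?_
          rw [norm_mul (2 * τ)]
      _ = (∫ t in Set.Ioi (0 : ℝ), ‖(t : ℂ) ^ (s + 1 - 1) * Complex.exp (-t / 2) * f t‖) +
          ‖2 * τ‖ * (∫ t in Set.Ioi (0 : ℝ), ‖(t : ℂ) ^ (s - 1) * Complex.exp (-t / 2) * f t‖) +
          K * ∫ t in Set.Ioi (0 : ℝ), ‖(t : ℂ) ^ (s - 1) * Complex.exp (-t / 2) * g t‖ := by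
        refine (integral_add (i1.add i2) i3).trans ?_
        rw [integral_add' i1 i2, integral_const_mul, integral_const_mul]
      _ ≤ C₁ * Real.Gamma (s.re + N) + ‖2 * τ‖ * (C₁ * Real.Gamma (s.re + N)) +
          K * (C₂ * Real.Gamma (s.re + N)) := by
          gcongr
          · exact c1.trans (by gcongr)
          · exact c2.trans (by gcongr)
          · exact c3.trans (by gcongr)
      _ = _ := by ring

/-- Induction on half planes `Re τ < 1/2 + Re ω + n`: both `τ-1` and `τ-2` lie in the preceding one.
-/
theorem exists_isWhittakerOnHalfLine (τ ω : ℂ) : ∃ f, IsWhittakerOnHalfLine τ ω f := by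
  have key : ∀ (n : ℕ) (τ : ℂ), τ.re < 1 / 2 + ω.re + n → ∃ f, IsWhittakerOnHalfLine τ ω f := by
    intro n
    induction n with
    | zero =>
      intro τ h
      refine ⟨_, isWhittakerOnHalfLine_of_re_pos ?_⟩
      simp at h ⊢
      linarith
    | succ n ih =>
      intro τ h
      push_cast at h
      obtain ⟨f, hf⟩ := ih (τ - 1) (by simp at h ⊢; linarith)
      obtain ⟨g, hg⟩ := ih (τ - 1 - 1) (by simp at h ⊢; linarith)
      have := hf.step hg
      rw [sub_add_cancel] at this
      exact ⟨_, this⟩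
  obtain ⟨n, hn⟩ := exists_nat_gt (τ.re - (1 / 2 + ω.re))
  exact key n τ (by linarith)

/-! ### Convergence of the series of Gamma quotients -/

/-- By convexity of `log Γ`, its slope on `[x-1, x]`, which is `log(x-1)`, is at most its slope on
`[x, x+l]`. -/
theorem Real.Gamma_mul_rpow_le_Gamma_add {x l : ℝ} (hx : 1 < x) (hl : 0 < l) :
    Real.Gamma x * (x - 1) ^ l ≤ Real.Gamma (x + l) := by
  have h := Real.convexOn_log_Gamma.slope_mono_adjacent (x := x - 1) (y := x) (z := x + l)
    (by simp; linarith) (by simp; linarith) (by linarith) (by linarith)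
  have hx1 : 0 < x - 1 := by linarith
  have g1 : 0 < Real.Gamma (x - 1) := Real.Gamma_pos_of_pos hx1
  have g2 : 0 < Real.Gamma x := Real.Gamma_pos_of_pos (by linarith)
  have g3 : 0 < Real.Gamma (x + l) := Real.Gamma_pos_of_pos (by linarith)
  have e : Real.Gamma x = (x - 1) * Real.Gamma (x - 1) := by
    rw [← Real.Gamma_add_one hx1.ne', sub_add_cancel]
  have e2 : Real.log (Real.Gamma x) - Real.log (Real.Gamma (x - 1)) = Real.log (x - 1) := by
    rw [e, Real.log_mul hx1.ne' g1.ne']; ring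
  simp only [Function.comp] at h
  rw [e2, sub_sub_cancel, div_one, add_sub_cancel_left, le_div_iff₀ hl] at h
  rw [← Real.log_le_log_iff (by positivity) g3, Real.log_mul g2.ne' (by positivity),
    Real.log_rpow hx1]
  linarith

/-- The triangle inequality in the beta integral gives `|B(x,w)| ≤ B(x, Re w)`, which trades complex
Gamma values for real ones. At `x = 0` that integral diverges, but the bound is trivial. -/
theorem norm_inv_Gamma_ofReal_add_le {x : ℝ} (hx : 0 ≤ x) {w : ℂ} (hw : 0 < w.re) :
    ‖(Complex.Gamma (x + w))⁻¹‖ ≤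
      Real.Gamma w.re * ‖(Complex.Gamma w)⁻¹‖ * (Real.Gamma (x + w.re))⁻¹ := by
  have gw := Real.Gamma_pos_of_pos hw
  rcases hx.eq_or_lt with rfl | hx
  · simp only [Complex.ofReal_zero, zero_add]
    rw [mul_comm (Real.Gamma w.re), mul_assoc, mul_inv_cancel₀ gw.ne', mul_one]
  have gx := Real.Gamma_pos_of_pos hx
  have hxc : 0 < (x : ℂ).re := by simpa using hx
  have hwc : 0 < ((w.re : ℝ) : ℂ).re := by simpa using hw
  obtain ⟨-, v1⟩ := integrableOn_and_integral_cpow_mul_one_add_cpow hxc hw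
  obtain ⟨-, v2⟩ := integrableOn_and_integral_cpow_mul_one_add_cpow hxc hwc
  have e : ∀ u ∈ Set.Ioi (0 : ℝ), (u : ℂ) ^ ((x : ℂ) - 1) * (1 + u : ℂ) ^ (-((x : ℂ) + w.re)) =
      ((‖(u : ℂ) ^ ((x : ℂ) - 1) * (1 + u : ℂ) ^ (-((x : ℂ) + w))‖ : ℝ) : ℂ) := by
    intro u hu
    have hu' : 0 < u := hu
    rw [norm_mul, norm_one_add_ofReal_cpow hu, Complex.norm_cpow_eq_rpow_re_of_pos hu,
      Complex.ofReal_mul, Complex.ofReal_cpow hu'.le, Complex.ofReal_cpow (by linarith)]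
    simp
  rw [setIntegral_congr_fun measurableSet_Ioi e, integral_complex_ofReal] at v2
  have h := norm_integral_le_integral_norm (μ := volume.restrict (Set.Ioi 0))
    fun u : ℝ => (u : ℂ) ^ ((x : ℂ) - 1) * (1 + u : ℂ) ^ (-((x : ℂ) + w))
  rw [← Complex.ofReal_add, Complex.Gamma_ofReal, Complex.Gamma_ofReal, Complex.Gamma_ofReal,
    ← Complex.ofReal_mul, ← Complex.ofReal_div, Complex.ofReal_inj] at v2
  rw [v1, v2, norm_div, norm_mul, Complex.Gamma_ofReal, Complex.norm_real,
    Real.norm_of_nonneg gx.le] at h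
  have gwc : 0 < ‖Complex.Gamma w‖ := norm_pos_iff.2 (Complex.Gamma_ne_zero_of_re_pos hw)
  rw [norm_inv, norm_inv]
  have h' : Real.Gamma x * (‖Complex.Gamma w‖ * ‖Complex.Gamma (x + w)‖⁻¹) ≤
      Real.Gamma x * (Real.Gamma w.re * (Real.Gamma (x + w.re))⁻¹) := by
    simpa only [div_eq_mul_inv, mul_assoc] using h
  have h2 := le_of_mul_le_mul_left h' gx
  calc ‖Complex.Gamma (x + w)‖⁻¹ = ‖Complex.Gamma w‖⁻¹ *
        (‖Complex.Gamma w‖ * ‖Complex.Gamma (x + w)‖⁻¹) := by field_simp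
    _ ≤ ‖Complex.Gamma w‖⁻¹ * (Real.Gamma w.re * (Real.Gamma (x + w.re))⁻¹) := by gcongr
    _ = _ := by ring

/-- The ratio bound behaves like a constant times `k^(2-l-a)`; in the boundary case `l = a = 1` its
limit is `4r`. -/
theorem tendsto_gammaQuotient_ratio {l a σ r : ℝ} (hl : 0 < l) (ha : 0 < a)
    (h : 2 < l + a ∨ (l = 1 ∧ a = 1 ∧ 4 * r < 1)) :
    ∃ ρ < 1, Tendsto (fun k : ℕ => r * (2 * k + σ + 1) ^ 2 * ((l * k : ℝ) ^ l * (a * k : ℝ) ^ a)⁻¹)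
      atTop (𝓝 ρ) := by
  have t1 : Tendsto (fun k : ℕ => (2 + (σ + 1) * (k : ℝ)⁻¹) ^ 2) atTop (𝓝 ((2 + (σ + 1) * 0) ^ 2)) :=
    ((tendsto_inv_atTop_nhds_zero_nat.const_mul (σ + 1)).const_add 2).pow 2
  have e : ∀ k : ℕ, 0 < k → r * (2 * k + σ + 1) ^ 2 * ((l * k : ℝ) ^ l * (a * k : ℝ) ^ a)⁻¹ =
      r * (l ^ l * a ^ a)⁻¹ * (2 + (σ + 1) * (k : ℝ)⁻¹) ^ 2 * (k : ℝ) ^ (-(l + a - 2)) := by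
    intro k hk
    have hk' : (0 : ℝ) < k := by exact_mod_cast hk
    have p1 : 0 < (k : ℝ) ^ l := by positivity
    have p2 : 0 < (k : ℝ) ^ a := by positivity
    rw [Real.mul_rpow hl.le hk'.le, Real.mul_rpow ha.le hk'.le, Real.rpow_neg hk'.le,
      Real.rpow_sub hk', Real.rpow_add hk', Real.rpow_two]
    field_simp
    ring
  rcases h with h | ⟨rfl, rfl, h⟩
  · have t2 : Tendsto (fun k : ℕ => (k : ℝ) ^ (-(l + a - 2))) atTop (𝓝 0) :=
      (tendsto_rpow_neg_atTop (by linarith)).comp tendsto_natCast_atTop_atTop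
    refine ⟨0, one_pos, ?_⟩
    have := (t1.const_mul (r * (l ^ l * a ^ a)⁻¹)).mul t2
    rw [mul_zero] at this
    refine this.congr' ?_
    filter_upwards [eventually_gt_atTop 0] with k hk
    exact (e k hk).symm
  · refine ⟨4 * r, h, ?_⟩
    have := t1.const_mul r
    rw [show r * (2 + (σ + 1) * 0) ^ 2 = 4 * r by ring] at this
    refine this.congr' ?_
    filter_upwards [eventually_gt_atTop 0] with k hk
    rw [e k hk]
    norm_num

theorem summable_real_gammaQuotient {l a σ m n r : ℝ} (hl : 0 < l) (ha : 0 < a) (hσ : 0 < σ)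
    (hm : 1 < m) (hn : 1 < n) (hr : 0 ≤ r) (h : 2 < l + a ∨ (l = 1 ∧ a = 1 ∧ 4 * r < 1)) :
    Summable fun k : ℕ => Real.Gamma (2 * k + σ) * (Real.Gamma (l * k + m))⁻¹ *
      (Real.Gamma (a * k + n))⁻¹ * r ^ k := by
  obtain ⟨ρ, hρ, hlim⟩ := tendsto_gammaQuotient_ratio (σ := σ) hl ha h
  obtain ⟨q, hρq, hq⟩ := exists_between hρ
  refine summable_of_ratio_norm_eventually_le hq ?_
  filter_upwards [hlim.eventually_lt_const hρq, eventually_gt_atTop 0] with k hk hk0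
  have hk' : (0 : ℝ) < k := by exact_mod_cast hk0
  have hinv : ∀ b m : ℝ, 0 < b → 1 < m → 0 < Real.Gamma (b * k + m) ∧
      0 < Real.Gamma (b * (k + 1 : ℕ) + m) ∧
      (Real.Gamma (b * (k + 1 : ℕ) + m))⁻¹ ≤ (Real.Gamma (b * k + m))⁻¹ * ((b * k) ^ b)⁻¹ := by
    intro b m hb hm
    have hbk : 0 < b * k := by positivity
    have g0 : 0 < Real.Gamma (b * k + m) := Real.Gamma_pos_of_pos (by linarith)
    have h1 := Real.Gamma_mul_rpow_le_Gamma_add (x := b * k + m) (l := b) (by linarith) hb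
    have h2 : (b * k) ^ b ≤ (b * k + m - 1) ^ b :=
      Real.rpow_le_rpow hbk.le (by linarith) hb.le
    have e : b * ((k + 1 : ℕ) : ℝ) + m = b * k + m + b := by push_cast; ring
    have h3 : Real.Gamma (b * k + m) * (b * k) ^ b ≤ Real.Gamma (b * (k + 1 : ℕ) + m) := by
      rw [e]; exact le_trans (by gcongr) h1
    have h4 : 0 < Real.Gamma (b * k + m) * (b * k) ^ b := by positivity
    refine ⟨g0, h4.trans_le h3, ?_⟩
    rw [← mul_inv]
    exact inv_anti₀ h4 h3
  obtain ⟨l0, l1, l2⟩ := hinv l m hl hm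
  obtain ⟨a0, a1, a2⟩ := hinv a n ha hn
  have g0 : 0 < Real.Gamma (2 * k + σ) := Real.Gamma_pos_of_pos (by positivity)
  have g1 : Real.Gamma (2 * (k + 1 : ℕ) + σ) ≤ (2 * k + σ + 1) ^ 2 * Real.Gamma (2 * k + σ) := by
    have e : 2 * ((k + 1 : ℕ) : ℝ) + σ = 2 * k + σ + 1 + 1 := by push_cast; ring
    rw [e, Real.Gamma_add_one (by positivity), Real.Gamma_add_one (by positivity), ← mul_assoc]
    gcongr
    nlinarith
  have g2 : 0 < Real.Gamma (2 * (k + 1 : ℕ) + σ) := Real.Gamma_pos_of_pos (by positivity)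
  rw [Real.norm_of_nonneg (by positivity), Real.norm_of_nonneg (by positivity)]
  calc _ ≤ ((2 * k + σ + 1) ^ 2 * Real.Gamma (2 * k + σ)) *
        ((Real.Gamma (l * k + m))⁻¹ * ((l * k) ^ l)⁻¹) *
        ((Real.Gamma (a * k + n))⁻¹ * ((a * k) ^ a)⁻¹) * r ^ (k + 1) := by gcongr
    _ = (r * (2 * k + σ + 1) ^ 2 * ((l * k : ℝ) ^ l * (a * k : ℝ) ^ a)⁻¹) *
        (Real.Gamma (2 * k + σ) * (Real.Gamma (l * k + m))⁻¹ *
        (Real.Gamma (a * k + n))⁻¹ * r ^ k) := by rw [mul_inv, pow_succ]; ring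
    _ ≤ _ := by gcongr

/-- Dropping finitely many terms pushes all real parts far enough right to replace the complex
Gammas by real ones. For `r = 0` only the term `k = 0` can survive. -/
theorem summable_gammaQuotient {l a r : ℝ} (hl : 0 < l) (ha : 0 < a) (μ ν : ℂ) (σ : ℝ)
    (hr : 0 ≤ r) (h : 2 < l + a ∨ (l = 1 ∧ a = 1 ∧ 4 * r < 1) ∨ r = 0) :
    Summable fun k : ℕ => Real.Gamma (2 * k + σ) * ‖(Complex.Gamma (l * k + μ))⁻¹‖ *
      ‖(Complex.Gamma (a * k + ν))⁻¹‖ * r ^ k := by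
  rcases eq_or_ne r 0 with rfl | hr0
  · rw [← summable_nat_add_iff 1]
    simp
  have h' : 2 < l + a ∨ (l = 1 ∧ a = 1 ∧ 4 * r < 1) := by tauto
  have ex : ∀ b x : ℝ, 0 < b → ∀ᶠ k : ℕ in atTop, 1 < b * k + x := by
    intro b x hb
    have : Tendsto (fun k : ℕ => b * (k : ℝ) + x) atTop atTop :=
      tendsto_atTop_add_const_right _ _ (tendsto_natCast_atTop_atTop.const_mul_atTop hb)
    exact this.eventually_gt_atTop 1
  obtain ⟨K, hK1, hK2, hK3⟩ :=
    ((ex 2 σ two_pos).and ((ex l μ.re hl).and (ex a ν.re ha))).exists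
  rw [← summable_nat_add_iff K]
  have hμ : 1 < (l * K + μ : ℂ).re := by simpa using hK2
  have hν : 1 < (a * K + ν : ℂ).re := by simpa using hK3
  have S := (summable_real_gammaQuotient (σ := 2 * K + σ) (m := (l * K + μ : ℂ).re)
    (n := (a * K + ν : ℂ).re) hl ha (by linarith) hμ hν hr h').mul_left
    (Real.Gamma (l * K + μ : ℂ).re * ‖(Complex.Gamma (l * K + μ))⁻¹‖ *
      (Real.Gamma (a * K + ν : ℂ).re * ‖(Complex.Gamma (a * K + ν))⁻¹‖) * r ^ K)
  refine S.of_norm_bounded fun k => ?_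
  have g0 : 0 < Real.Gamma (2 * k + (2 * K + σ)) := Real.Gamma_pos_of_pos (by positivity)
  have e0 : 2 * ((k + K : ℕ) : ℝ) + σ = 2 * k + (2 * K + σ) := by push_cast; ring
  have e1 : ∀ (b : ℝ) (z : ℂ), b * ((k + K : ℕ) : ℂ) + z = ((b * k : ℝ) : ℂ) + (b * K + z) := by
    intro b z; push_cast; ring
  have b1 := norm_inv_Gamma_ofReal_add_le (x := l * k) (by positivity) (w := l * K + μ)
    (by linarith)
  have b2 := norm_inv_Gamma_ofReal_add_le (x := a * k) (by positivity) (w := a * K + ν)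
    (by linarith)
  have gl : 0 < Real.Gamma (l * k + (l * K + μ : ℂ).re) := Real.Gamma_pos_of_pos (by positivity)
  have gl' : 0 < Real.Gamma (l * K + μ : ℂ).re := Real.Gamma_pos_of_pos (by linarith)
  rw [e0, e1, e1, Real.norm_of_nonneg (by positivity)]
  calc _ ≤ Real.Gamma (2 * k + (2 * K + σ)) *
        (Real.Gamma (l * K + μ : ℂ).re * ‖(Complex.Gamma (l * K + μ))⁻¹‖ *
          (Real.Gamma (l * k + (l * K + μ : ℂ).re))⁻¹) *
        (Real.Gamma (a * K + ν : ℂ).re * ‖(Complex.Gamma (a * K + ν))⁻¹‖ *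
          (Real.Gamma (a * k + (a * K + ν : ℂ).re))⁻¹) * r ^ (k + K) := by gcongr
    _ = _ := by rw [pow_add]; ring

/-! ### Termwise integration and principal powers -/

/-- Tonelli makes the sum of norms integrable, hence finite almost everywhere; measurability follows
since partial sums converge almost everywhere. -/
theorem MeasureTheory.integrable_tsum_of_summable_integral_norm {X : Type*} [MeasurableSpace X]
    {μ : Measure X} {F : ℕ → X → ℂ} (hF : ∀ n, Integrable (F n) μ)
    (hs : Summable fun n => ∫ x, ‖F n x‖ ∂μ) : Integrable (fun x => ∑' n, F n x) μ := by
  have h1 : ∑' n, ∫⁻ x, ‖F n x‖ₑ ∂μ ≠ ⊤ := by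
    have : ∀ n, ∫⁻ x, ‖F n x‖ₑ ∂μ = ENNReal.ofReal (∫ x, ‖F n x‖ ∂μ) := fun n =>
      (ofReal_integral_norm_eq_lintegral_enorm (hF n)).symm
    simp only [this]
    exact hs.tsum_ofReal_ne_top
  have hm : ∀ n, AEMeasurable (fun x => ‖F n x‖ₑ) μ := fun n => (hF n).1.enorm
  have h2 : ∫⁻ x, ∑' n, ‖F n x‖ₑ ∂μ ≠ ⊤ := by rwa [lintegral_tsum hm]
  have h3 : ∀ᵐ x ∂μ, Summable fun n => F n x := by
    filter_upwards [ae_lt_top' (AEMeasurable.tsum hm) h2] with x hx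
    apply Summable.of_norm
    have := ENNReal.summable_toReal hx.ne
    simpa using this
  constructor
  · refine aestronglyMeasurable_of_tendsto_ae atTop
      (f := fun n x => ∑ i ∈ Finset.range n, F i x)
      (fun n => Finset.aestronglyMeasurable_fun_sum _ fun i _ => (hF i).1) ?_
    filter_upwards [h3] with x hx
    exact hx.hasSum.tendsto_sum_nat
  · refine lt_of_le_of_lt (lintegral_mono fun x => enorm_tsum_le_tsum_enorm) ?_
    exact h2.lt_top

theorem Complex.mul_ofReal_cpow {t : ℝ} (ht : 0 < t) (z s : ℂ) (hs : s ≠ 0) :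
    (z * t) ^ s = z ^ s * (t : ℂ) ^ s := by
  have ht0 : (t : ℂ) ≠ 0 := by exact_mod_cast ht.ne'
  rcases eq_or_ne z 0 with rfl | hz
  · simp [hs]
  · rw [Complex.cpow_def_of_ne_zero (mul_ne_zero hz ht0), Complex.cpow_def_of_ne_zero hz,
      Complex.cpow_def_of_ne_zero ht0, mul_comm z, Complex.log_ofReal_mul ht hz,
      Complex.ofReal_log ht.le, ← Complex.exp_add]
    ring_nf

/-- Only the integer power `2k` is split off, so no branch question arises. At `x = 0`, `Re p > 0`
keeps both exponents nonzero, avoiding `0^0 = 1`. -/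
theorem sqrt_half_cpow {p : ℂ} (hp : 0 < p.re) (x : ℂ) (k : ℕ) :
    (x ^ (1 / 2 : ℂ) / 2) ^ (2 * k + p + 1 : ℂ) =
      (x ^ (1 / 2 : ℂ) / 2) ^ (p + 1) * (x / 4) ^ k := by
  set z := x ^ (1 / 2 : ℂ) / 2 with hz
  have hz2 : z ^ 2 = x / 4 := by
    rw [hz, div_pow, one_div, Complex.cpow_ofNat_inv_pow]; norm_num
  have hp1 : p + 1 ≠ 0 := by
    intro h
    have := congrArg Complex.re h
    simp at this
    linarith
  have hp2 : 2 * k + p + 1 ≠ 0 := by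
    intro h
    have := congrArg Complex.re h
    simp at this
    have : (0 : ℝ) ≤ k := Nat.cast_nonneg k
    linarith
  rcases eq_or_ne z 0 with h0 | h0
  · rw [h0, Complex.zero_cpow hp1, Complex.zero_cpow hp2, zero_mul]
  · rw [show 2 * k + p + 1 = (p + 1) + ((2 * k : ℕ) : ℂ) by push_cast; ring,
      Complex.cpow_add _ _ h0, Complex.cpow_natCast, pow_mul, hz2]

/-! ### The Whittaker transform -/

theorem theorem2p3 (a : ℕ) (ha : 0 < a) (p b c μ τ ω ζ x : ℂ) (ξ l : ℝ)
    (hξ : 0 < ξ) (hl : 0 < l) (hp : 0 < p.re) (hζ : 0 < ζ.re)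
    (hplus : -(1 / 2) < (ζ + ω).re) (hminus : -(1 / 2) < (ζ - ω).re)
    (hconv : 2 < l + a ∨ (l + a = 2 ∧ ‖c * x‖ < 1) ∨ c = 0) :
    IntegrableOn (fun t : ℝ => (t : ℂ) ^ (ζ - 1) * Complex.exp (-(t : ℂ) / 2) *
        whittakerW τ ω t * galueStruve a p b c ξ l μ (x ^ (1 / 2 : ℂ) * t))
      (Set.Ioi 0) ∧
    Summable (wrightTerm
      ![(ω + ζ + p + 3 / 2, 2), (-ω + ζ + p + 3 / 2, 2), (1, 1)]
      ![(μ, l), (p / ξ + b / 2 + 1, (a : ℝ)), (-τ + ζ + p + 2, 2)]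
      (-c * x / 4)) ∧
    ∫ t in Set.Ioi (0 : ℝ), (t : ℂ) ^ (ζ - 1) * Complex.exp (-(t : ℂ) / 2) *
        whittakerW τ ω t * galueStruve a p b c ξ l μ (x ^ (1 / 2 : ℂ) * t) =
      (x ^ (1 / 2 : ℂ) / 2) ^ (p + 1) *
        wrightPsi
          ![(ω + ζ + p + 3 / 2, 2), (-ω + ζ + p + 3 / 2, 2), (1, 1)]
          ![(μ, l), (p / ξ + b / 2 + 1, (a : ℝ)), (-τ + ζ + p + 2, 2)]
          (-c * x / 4) := by
  obtain ⟨f, hf⟩ := exists_isWhittakerOnHalfLine τ ω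
  obtain ⟨C, N, σ₀, hC, hbound⟩ := hf.integral_norm_le
  have ha' : (0 : ℝ) < a := by exact_mod_cast ha
  set ν : ℂ := p / ξ + (b + 2) / 2 with hν
  let s : ℕ → ℂ := fun k => ζ + p + 1 + 2 * k
  let Y : ℕ → ℂ := fun k =>
    (-c) ^ k / (Complex.Gamma (l * k + μ) * Complex.Gamma (a * k + ν)) * (x / 4) ^ k
  let H : ℕ → ℝ → ℂ := fun k t =>
    Y k * ((t : ℂ) ^ (s k - 1) * Complex.exp (-t / 2) * f t)
  have hsre : ∀ k, (s k).re = ζ.re + p.re + 1 + 2 * k := fun k => by simp [s]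
  have hs1 : ∀ k, -(1 / 2) < (s k + ω).re := fun k => by
    have : (0 : ℝ) ≤ k := Nat.cast_nonneg k
    rw [Complex.add_re] at hplus ⊢
    rw [hsre]; linarith
  have hs2 : ∀ k, -(1 / 2) < (s k - ω).re := fun k => by
    have : (0 : ℝ) ≤ k := Nat.cast_nonneg k
    rw [Complex.sub_re] at hminus ⊢
    rw [hsre]; linarith
  have hHint : ∀ k, IntegrableOn (H k) (Set.Ioi 0) := fun k =>
    (hf.integrableOn (s k) (hs1 k) (hs2 k)).const_mul (Y k)
  have hYnorm : ∀ k, ‖Y k‖ = ‖(Complex.Gamma (l * k + μ))⁻¹‖ *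
      ‖(Complex.Gamma ((a : ℝ) * k + ν))⁻¹‖ * (‖c * x‖ / 4) ^ k := by
    intro k
    simp only [Y, norm_mul, norm_div, norm_pow, norm_neg, norm_inv]
    rw [show ‖(4 : ℂ)‖ = 4 by simp]
    push_cast
    rw [div_pow, div_pow, mul_pow]
    field_simp
  have hr : 2 < l + a ∨ (l = 1 ∧ (a : ℝ) = 1 ∧ 4 * (‖c * x‖ / 4) < 1) ∨ ‖c * x‖ / 4 = 0 := by
    rcases hconv with h | ⟨h, h'⟩ | h
    · exact Or.inl h
    · have h2 : (a : ℝ) < 2 := by linarith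
      have h3 : a < 2 := by exact_mod_cast h2
      -- With `λ > 0` and `a ≥ 1` an integer, `λ + a = 2` forces `λ = a = 1`.
      have h4 : a = 1 := by omega
      rw [h4, Nat.cast_one] at h ⊢
      exact Or.inr (Or.inl ⟨by linarith, rfl, by linarith⟩)
    · exact Or.inr (Or.inr (by simp [h]))
  have hsumH : Summable fun k => ∫ t in Set.Ioi (0 : ℝ), ‖H k t‖ := by
    have S := (summable_gammaQuotient hl ha' μ ν (ζ.re + p.re + 1 + N) (by positivity) hr).mul_left C
    -- The moment bound holds only once `Re s` reaches `σ₀`, that is, for all but finitely many `k`.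
    refine S.of_norm_bounded_eventually_nat ?_
    obtain ⟨K, hK⟩ := exists_nat_ge σ₀
    filter_upwards [eventually_ge_atTop K] with k hk
    have hk' : (K : ℝ) ≤ k := by exact_mod_cast hk
    have hbd := hbound (s k) (by
      rw [hsre]
      have : (0 : ℝ) ≤ k := Nat.cast_nonneg k
      linarith)
    simp only [H, norm_mul (Y k)]
    rw [integral_const_mul, hYnorm, Real.norm_of_nonneg (by positivity)]
    calc _ ≤ ‖(Complex.Gamma (l * k + μ))⁻¹‖ * ‖(Complex.Gamma ((a : ℝ) * k + ν))⁻¹‖ *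
          (‖c * x‖ / 4) ^ k * (C * Real.Gamma ((s k).re + N)) := by gcongr
      _ = _ := by
        rw [hsre, show ζ.re + p.re + 1 + 2 * (k : ℝ) + N = 2 * k + (ζ.re + p.re + 1 + N) by ring]
        push_cast
        ring
  have hterm : ∀ k, ∫ t in Set.Ioi (0 : ℝ), H k t = wrightTerm
      ![(ω + ζ + p + 3 / 2, 2), (-ω + ζ + p + 3 / 2, 2), (1, 1)]
      ![(μ, l), (p / ξ + b / 2 + 1, (a : ℝ)), (-τ + ζ + p + 2, 2)] (-c * x / 4) k := by
    intro k
    simp only [H]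
    rw [integral_const_mul, hf.integral_eq (s k) (hs1 k) (hs2 k)]
    have hfac : (k.factorial : ℂ) ≠ 0 := by exact_mod_cast k.factorial_ne_zero
    have g1 : Complex.Gamma (1 + k) = k.factorial := by
      rw [add_comm]; exact Complex.Gamma_nat_eq_factorial k
    simp only [wrightTerm, Fin.prod_univ_three, Matrix.cons_val_zero, Matrix.cons_val_one,
      Matrix.cons_val, Complex.ofReal_ofNat, Complex.ofReal_one, one_mul, g1,
      Complex.ofReal_natCast, Y, s]
    rw [show 1 / 2 + ω + (ζ + p + 1 + 2 * (k : ℂ)) = ω + ζ + p + 3 / 2 + 2 * k by ring,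
      show 1 / 2 - ω + (ζ + p + 1 + 2 * (k : ℂ)) = -ω + ζ + p + 3 / 2 + 2 * k by ring,
      show 1 - τ + (ζ + p + 1 + 2 * (k : ℂ)) = -τ + ζ + p + 2 + 2 * k by ring,
      show (l : ℂ) * k + μ = μ + l * k by ring,
      show (a : ℂ) * k + ν = p / ξ + b / 2 + 1 + a * k by rw [hν]; ring,
      show -c * x / 4 = -c * (x / 4) by ring, mul_pow, ← mul_assoc,
      mul_comm _ (k.factorial : ℂ), mul_comm _ (k.factorial : ℂ), mul_assoc (k.factorial : ℂ),
      mul_assoc (k.factorial : ℂ),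
      mul_div_mul_left _ _ hfac]
    simp only [div_eq_mul_inv, mul_inv]
    ring
  have hEq : ∀ t ∈ Set.Ioi (0 : ℝ), (t : ℂ) ^ (ζ - 1) * Complex.exp (-(t : ℂ) / 2) *
        whittakerW τ ω t * galueStruve a p b c ξ l μ (x ^ (1 / 2 : ℂ) * t) =
      (x ^ (1 / 2 : ℂ) / 2) ^ (p + 1) * ∑' k, H k t := by
    intro t ht
    have ht' : 0 < t := ht
    have ht0 : (t : ℂ) ≠ 0 := by exact_mod_cast ht'.ne'
    rw [hf.whittakerW_eq ht', galueStruve, ← tsum_mul_left, ← tsum_mul_left]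
    congr 1 with k
    have hk : 2 * (k : ℂ) + p + 1 ≠ 0 := by
      intro h
      have := congrArg Complex.re h
      simp at this
      have : (0 : ℝ) ≤ k := Nat.cast_nonneg k
      linarith
    rw [show x ^ (1 / 2 : ℂ) * t / 2 = x ^ (1 / 2 : ℂ) / 2 * t by ring,
      Complex.mul_ofReal_cpow ht' _ _ hk, sqrt_half_cpow hp]
    have e : (t : ℂ) ^ (s k - 1) = (t : ℂ) ^ (ζ - 1) * (t : ℂ) ^ (2 * k + p + 1 : ℂ) := by
      rw [← Complex.cpow_add _ _ ht0]
      congr 1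
      simp only [s]; ring
    simp only [H, Y, e, hν, add_assoc]
    ring
  have hS := hasSum_integral_of_summable_integral_norm hHint hsumH
  simp only [hterm] at hS
  refine ⟨?_, hS.summable, ?_⟩
  · exact IntegrableOn.congr_fun
      ((integrable_tsum_of_summable_integral_norm hHint hsumH).const_mul
        ((x ^ (1 / 2 : ℂ) / 2) ^ (p + 1)))
      (fun t ht => (hEq t ht).symm) measurableSet_Ioi
  · rw [setIntegral_congr_fun measurableSet_Ioi hEq, integral_const_mul, wrightPsi, hS.tsum_eq]
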